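/- Let $n\ge 2$ and let $B=(b^j_k)\in\mathbb Z^{n\times n}$ be such that $$\mathcal U_B=\Big\{z\in\mathbb C^n:\ \prod_{k=1}^n|z_k|^{b^j_k}<1\ \text{ for } 1\le j\le n\Big\}$$ is a nonempty bounded domain (where $0^0=1$, and $z_k\ne0$ is required whenever some $b^j_k<0$), and suppose that $\mathcal U_B$ is not the unit polydisc $\mathbb D^n$. Then $\det B\neq 0$; let $\Delta=|\det B|\,B^{-1}$ (the adjugate of $B$ if, as one may assume by permuting the rows, $\det B>0$), and let $A\in\mathbb Z^{n\times n}$ be the matrix whose $j$-th column $a_j$ is the $j$-th column of $\Delta$ divided by the greatest common divisor of its entries. Write $\mathbb 1=(1,\dots,1)$, $\alpha=\mathbb 1A-\mathbb 1$, $$m=\#\{j:\mathbb 1a_j=\max_k\mathbb 1a_k\},\qquad p_*=\max_j\frac{2\,\mathbb 1a_j}{\mathbb 1a_j+1}.$$ Let $\Omega=\{z\in\mathbb D^n: z^A\in\mathcal U_B\}$, the punctured polydisc on which the map $z\mapsto z^A$ is a branched covering of $\mathcal U_B$, and let $\Gamma$ be its deck transformation group, consisting of the maps $$\sigma_\nu(z)=\big(e^{2\pi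 i c^1\nu}z_1,\dots,e^{2\pi i c^n\nu}z_n\big),\qquad \nu\in\mathbb Z^n,$$ where $c^1,\dots,c^n$ are the rows of $A^{-1}$. Suppose that $m>1$ and that the coordinates are ordered so that $\alpha_1=\dots=\alpha_m=\max_j\alpha_j$. Suppose further that for some $b\in\mathbb Z^n$ the monomial $e_b(z)=z^b$ is $\Gamma$-invariant on $\Omega$ and that $b_j=b_k=1$ for some $j<k\le m$. Then the Bergman projection $P_{\mathcal U_B}$, i.e. the orthogonal projection of $L^2(\mathcal U_B)$ onto its subspace of holomorphic functions, is not of restricted weak type $(p_*,p_*)$: there is no constant $C>0$ such that $$\big|\{z\in\mathcal U_B:|P_{\mathcal U_B}(1_E)(z)|>y\}\big|\le \frac{C^{p_*}}{y^{p_*}}\,|E|$$ for all measurable $E\subset\mathcal U_B$ and all $y>0$, where $|\cdot|$ is Lebesgue measure. -/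

import Mathlib

open MeasureTheory

namespace MonomialPolyhedra

/-- The domain `{z ∈ ℂⁿ : ∏ₖ |zₖ| ^ bʲₖ < 1 for every j}` of an integer matrix `B`, with `0 ^ 0 = 1`.
The powers have to make sense: `zₖ ≠ 0` is required as soon as some exponent of `zₖ` is negative. -/
def monomialDomain {n : ℕ} (B : Matrix (Fin n) (Fin n) ℤ) : Set (Fin n → ℂ) :=
  {z | ∀ j, (∀ k, B j k < 0 → z k ≠ 0) ∧ ∏ k, ‖z k‖ ^ B j k < 1}

/-- The unit polydisc in `ℂⁿ`. -/
def unitPolydisc (n : ℕ) : Set (Fin n → ℂ) := {z | ∀ k, ‖z k‖ < 1}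

/-- `B` defines a monomial polyhedron: its domain is bounded and nonempty
(it is then automatically open and connected). -/
structure IsMonomialPolyhedron {n : ℕ} (B : Matrix (Fin n) (Fin n) ℤ) : Prop where
  nonempty : (monomialDomain B).Nonempty
  bounded : Bornology.IsBounded (monomialDomain B)

/-- The matrix `|det B| • B⁻¹`, that is, the adjugate of `B` when `det B > 0`. The sign makes it
independent, up to a permutation of its columns, of the order of the rows of `B`, and allows us not
to assume that the rows have been ordered so that `det B > 0`. -/
def signedAdjugate {n : ℕ} (B : Matrix (Fin n) (Fin n) ℤ) : Matrix (Fin n) (Fin n) ℤ :=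
  B.det.sign • B.adjugate

/-- The matrix `A`: each column of `signedAdjugate B` is divided by the gcd of its entries. -/
def matrixA {n : ℕ} (B : Matrix (Fin n) (Fin n) ℤ) : Matrix (Fin n) (Fin n) ℤ :=
  Matrix.of fun i j =>
    signedAdjugate B i j / Finset.univ.gcd (fun l => signedAdjugate B l j)

/-- The row vector `𝟙 A` of the column sums of `A`. -/
def colSum {n : ℕ} (B : Matrix (Fin n) (Fin n) ℤ) (j : Fin n) : ℤ := ∑ i, matrixA B i j

/-- The row vector `α = 𝟙 A - 𝟙`. -/
def alpha {n : ℕ} (B : Matrix (Fin n) (Fin n) ℤ) (j : Fin n) : ℤ := colSum B j - 1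

/-- The number `m` of largest elements of the tuple `𝟙 A`. -/
def numMax {n : ℕ} (B : Matrix (Fin n) (Fin n) ℤ) : ℕ :=
  (Finset.univ.filter fun j => ∀ k, colSum B k ≤ colSum B j).card

/-- The exponent `p_* = max_j 2 (𝟙 a_j) / (𝟙 a_j + 1)`. -/
noncomputable def pStar {n : ℕ} (B : Matrix (Fin n) (Fin n) ℤ) : ℝ :=
  ⨆ j, 2 * (colSum B j : ℝ) / ((colSum B j : ℝ) + 1)

/-- The monomial `e_β(z) = z ^ β` with integer exponents. -/
noncomputable def monomial {n : ℕ} (β : Fin n → ℤ) (z : Fin n → ℂ) : ℂ := ∏ k, z k ^ β k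

/-- The monomial map `φ(z) = z ^ A`. -/
noncomputable def coveringMap {n : ℕ} (B : Matrix (Fin n) (Fin n) ℤ) (z : Fin n → ℂ) :
    Fin n → ℂ :=
  fun i => monomial (matrixA B i) z

/-- The punctured polydisc `Ω` on which `φ : Ω → 𝒰_B` is a branched covering: the points of the
unit polydisc that `φ` maps into the domain. -/
def coveringPolydisc {n : ℕ} (B : Matrix (Fin n) (Fin n) ℤ) : Set (Fin n → ℂ) :=
  {z | z ∈ unitPolydisc n ∧ coveringMap B z ∈ monomialDomain B}

/-- The deck transformation `σ_ν`, which multiplies `z_j` by `exp (2πi c^j ν)`, where `c^j` is the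
`j`-th row of `A⁻¹`. -/
noncomputable def deckTransformation {n : ℕ} (B : Matrix (Fin n) (Fin n) ℤ) (ν : Fin n → ℤ)
    (z : Fin n → ℂ) : Fin n → ℂ :=
  fun j => Complex.exp (2 * Real.pi * Complex.I *
    ∑ k, ((matrixA B).map (Int.cast : ℤ → ℂ))⁻¹ j k * (ν k : ℂ)) * z j

/-- A function on `Ω` is `Γ`-invariant, where `Γ` is the group of all `σ_ν`, `ν ∈ ℤⁿ`. -/
def IsDeckInvariant {n : ℕ} (B : Matrix (Fin n) (Fin n) ℤ) (f : (Fin n → ℂ) → ℂ) : Prop :=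
  ∀ ν : Fin n → ℤ, ∀ z ∈ coveringPolydisc B, f (deckTransformation B ν z) = f z

/-- The Bergman space of `U`: the classes in `L²(U)` that contain a holomorphic function. -/
def bergmanSpace {n : ℕ} (U : Set (Fin n → ℂ)) :
    Submodule ℂ (Lp ℂ 2 (volume.restrict U)) where
  carrier := {f | ∃ g : (Fin n → ℂ) → ℂ, DifferentiableOn ℂ g U ∧ f =ᵐ[volume.restrict U] g}
  zero_mem' := ⟨0, differentiableOn_const 0, Lp.coeFn_zero _ _ _⟩
  add_mem' := by
    rintro f₁ f₂ ⟨g₁, h₁, e₁⟩ ⟨g₂, h₂, e₂⟩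
    exact ⟨g₁ + g₂, h₁.add h₂, (Lp.coeFn_add f₁ f₂).trans (e₁.add e₂)⟩
  smul_mem' := by
    rintro c f ⟨g, h, e⟩
    exact ⟨c • g, h.const_smul c, (Lp.coeFn_smul c f).trans (e.const_smul c)⟩

/-- The Bergman projection of `U`: the orthogonal projection of `L²(U)` onto the Bergman space.
(For open `U` the Bergman space is closed, hence equal to its closure.) -/
noncomputable def bergmanProjection {n : ℕ} (U : Set (Fin n → ℂ)) :
    Lp ℂ 2 (volume.restrict U) →L[ℂ] Lp ℂ 2 (volume.restrict U) :=
  (bergmanSpace U).topologicalClosure.starProjection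

/-- A linear operator, here defined on `L²` and so on all simple functions with support of finite
measure, is of restricted weak type `(p, p)`: there is `C > 0` with
`ν {|T 1_E| > y} ≤ (C ^ p / y ^ p) μ(E)` for all measurable `E` of finite measure and all `y > 0`. -/
def IsRestrictedWeakType {X Y : Type*} [MeasurableSpace X] [MeasurableSpace Y]
    {μ : Measure X} {ν : Measure Y} (T : Lp ℂ 2 μ →L[ℂ] Lp ℂ 2 ν) (p : ℝ) : Prop :=
  ∃ C : ℝ, 0 < C ∧ ∀ (E : Set X) (hE : MeasurableSet E) (hμE : μ E ≠ ⊤) (y : ℝ), 0 < y →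
    ν {x | y < ‖T (indicatorConstLp 2 hE hμE (1 : ℂ)) x‖} ≤
      ENNReal.ofReal (C ^ p / y ^ p) * μ E

end MonomialPolyhedra

open MonomialPolyhedra

/-! Write κ for the maximal column sum of `matrixA B`. In the logarithms s of the moduli on the
covering polydisc, the domain becomes the negative orthant, Lebesgue measure acquires the weight
exp(2 Σ (𝟙a_l) s_l), and a monomial z^β has modulus exp(Σ (b'_l − 𝟙a_l) s_l) with b' = (β + 𝟙)A. An
invariant monomial with two exponents 1 at maximal columns j, k yields a β with all b'_l ≥ 1 and
b'_j = b'_k = 1 (`exists_critical_exponent`). Then z^β lies in the Bergman space, but not in weak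
L^q for the dual exponent q = 2κ/(κ−1): modulus and weight are both constant along s_j + s_k =
const, so {|z^β| > e^{(κ−1)N−M}} has measure at least of order N e^{−2κN}, not merely e^{−2κN}
(`exists_distribution_lower_bound`).

The projection sends z^β/|z^β| to c z^β with c > 0, because averaging over the torus isolates one
Laurent coefficient. By self-adjointness c |∫_E z^β| ≤ ‖P 1_E‖₁
(`exists_norm_integral_monomial_le`). A restricted weak type bound on a domain of finite measure
makes the right side O(|E|^{1/p}) (`integral_norm_le_of_weakType`). Letting E range over subsets of
a level set F gives ∫_F |z^β| = O(|F|^{1/p}), a weak L^q bound for z^β, and the extra factor N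
contradicts it (`not_forall_distribution_le`). -/

namespace MonomialPolyhedra

/-! ### Logarithmic coordinates and what boundedness says about B -/

/-- The image of `monomialDomain B` under `z ↦ (log ‖z k‖)`, as an open cone in `ℝⁿ`. -/
def logCone {n : ℕ} (B : Matrix (Fin n) (Fin n) ℤ) : Set (Fin n → ℝ) :=
  {t | ∀ j, ∑ k, (B j k : ℝ) * t k < 0}

theorem prod_norm_zpow_eq_exp {n : ℕ} (β : Fin n → ℤ) {z : Fin n → ℂ} (hz : ∀ k, z k ≠ 0) :
    ∏ k, ‖z k‖ ^ β k = Real.exp (∑ k, (β k : ℝ) * Real.log ‖z k‖) := by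
  rw [Real.exp_sum]
  refine Finset.prod_congr rfl fun k _ => ?_
  rw [← Real.rpow_intCast, Real.rpow_def_of_pos (norm_pos_iff.2 (hz k)), mul_comm]

theorem norm_monomial {n : ℕ} (β : Fin n → ℤ) (z : Fin n → ℂ) :
    ‖monomial β z‖ = ∏ k, ‖z k‖ ^ β k := by
  simp [monomial, norm_prod, norm_zpow]

theorem mem_monomialDomain_iff {n : ℕ} (B : Matrix (Fin n) (Fin n) ℤ) {z : Fin n → ℂ}
    (hz : ∀ k, z k ≠ 0) :
    z ∈ monomialDomain B ↔ (fun k => Real.log ‖z k‖) ∈ logCone B := by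
  simp only [monomialDomain, logCone, Set.mem_ofPred_eq]
  refine forall_congr' fun j => ?_
  rw [prod_norm_zpow_eq_exp _ hz, Real.exp_lt_one_iff]
  exact ⟨fun h => h.2, fun h => ⟨fun k _ => hz k, h⟩⟩

theorem exp_mem_monomialDomain {n : ℕ} {B : Matrix (Fin n) (Fin n) ℤ} {t : Fin n → ℝ}
    (ht : t ∈ logCone B) : (fun k => (Real.exp (t k) : ℂ)) ∈ monomialDomain B := by
  rw [mem_monomialDomain_iff]
  · convert ht using 2 with k
    rw [Complex.norm_real, Real.norm_eq_abs, Real.abs_exp, Real.log_exp]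
  · intro k
    exact_mod_cast (Real.exp_pos _).ne'

/-- The given point may have zero coordinates. Their exponents are all nonnegative, so the defining
products stay below 1 when the zeros are replaced by a small ε > 0. -/
theorem logCone_nonempty {n : ℕ} {B : Matrix (Fin n) (Fin n) ℤ}
    (h : (monomialDomain B).Nonempty) : (logCone B).Nonempty := by
  obtain ⟨z, hz⟩ := h
  set y : ℝ → Fin n → ℂ := fun ε k => if z k = 0 then (ε : ℂ) else z k with hy
  have h0 : y 0 = z := by
    ext k
    by_cases hk : z k = 0 <;> simp [hy, hk]
  have hc : ∀ j, ∀ᶠ ε in nhdsWithin (0 : ℝ) (Set.Ioi 0), ∏ k, ‖y ε k‖ ^ B j k < 1 := by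
    intro j
    have hcont : ContinuousAt (fun ε : ℝ => ∏ k, ‖y ε k‖ ^ B j k) 0 := by
      refine tendsto_finsetProd _ fun k _ => ?_
      have h1 : ContinuousAt (fun ε : ℝ => ‖y ε k‖) 0 := by
        by_cases hk : z k = 0 <;> simp only [hy, hk, if_true, if_false] <;> fun_prop
      refine h1.zpow₀ _ ?_
      rw [h0]
      by_cases hk : B j k < 0
      · exact Or.inl (norm_ne_zero_iff.2 ((hz j).1 k hk))
      · exact Or.inr (not_lt.1 hk)
    have h2 : ∏ k, ‖y 0 k‖ ^ B j k < 1 := by rw [h0]; exact (hz j).2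
    exact (hcont.eventually_lt continuousAt_const h2).filter_mono nhdsWithin_le_nhds
  obtain ⟨ε, hε, hpos⟩ := ((Filter.eventually_all.2 hc).and self_mem_nhdsWithin).exists
  have hne : ∀ k, y ε k ≠ 0 := by
    intro k
    by_cases hk : z k = 0
    · simpa [hy, hk] using (ne_of_gt hpos)
    · simp [hy, hk]
  exact ⟨_, (mem_monomialDomain_iff B hne).1 fun j => ⟨fun k _ => hne k, hε j⟩⟩

/-- The set is closed under positive scaling, so a positive coordinate would exponentiate to an
unbounded family of points of the domain. -/
theorem nonpos_of_mem_logCone {n : ℕ} {B : Matrix (Fin n) (Fin n) ℤ}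
    (hb : Bornology.IsBounded (monomialDomain B)) {t : Fin n → ℝ} (ht : t ∈ logCone B)
    (k : Fin n) : t k ≤ 0 := by
  by_contra! hk
  obtain ⟨R, hR⟩ := hb.exists_norm_le
  have hs : ∀ s : ℝ, 0 < s → s * t k + 1 ≤ R := by
    intro s hs
    have hst : (fun k => s * t k) ∈ logCone B := by
      intro j
      have : ∑ k, (B j k : ℝ) * (s * t k) = s * ∑ k, (B j k : ℝ) * t k := by
        rw [Finset.mul_sum]; exact Finset.sum_congr rfl fun _ _ => by ring
      rw [this]
      exact mul_neg_of_pos_of_neg hs (ht j)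
    have h1 := (norm_le_pi_norm _ k).trans (hR _ (exp_mem_monomialDomain hst))
    rw [Complex.norm_real, Real.norm_eq_abs, Real.abs_exp] at h1
    exact (Real.add_one_le_exp _).trans h1
  have h2 := hs ((|R| + 1) / t k) (by positivity)
  rw [div_mul_cancel₀ _ hk.ne'] at h2
  linarith [le_abs_self R]

/-- Such a v is a recession direction: t + s v stays in the cone for every s ≥ 0, so a positive
coordinate of v would eventually dominate. -/
theorem nonpos_of_mulVec_nonpos {n : ℕ} {B : Matrix (Fin n) (Fin n) ℤ}
    (hB : IsMonomialPolyhedron B) {v : Fin n → ℝ} (hv : ∀ j, ∑ k, (B j k : ℝ) * v k ≤ 0)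
    (k : Fin n) : v k ≤ 0 := by
  obtain ⟨t, ht⟩ := logCone_nonempty hB.nonempty
  by_contra! hk
  have hs : ∀ s : ℝ, 0 ≤ s → t k + s * v k ≤ 0 := by
    intro s hs
    refine nonpos_of_mem_logCone (t := fun k => t k + s * v k) hB.bounded (fun j => ?_) k
    have : ∑ k, (B j k : ℝ) * (t k + s * v k)
        = ∑ k, (B j k : ℝ) * t k + s * ∑ k, (B j k : ℝ) * v k := by
      rw [Finset.mul_sum, ← Finset.sum_add_distrib]
      exact Finset.sum_congr rfl fun _ _ => by ring
    rw [this]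
    have := mul_nonpos_of_nonneg_of_nonpos hs (hv j)
    linarith [ht j]
  have h2 := hs ((|t k| + 1) / v k) (by positivity)
  rw [div_mul_cancel₀ _ hk.ne'] at h2
  linarith [neg_abs_le (t k)]

/-- A kernel vector and its negative are both recession directions, so every coordinate is both ≤ 0
and ≥ 0. -/
theorem det_ne_zero_of_isMonomialPolyhedron {n : ℕ} {B : Matrix (Fin n) (Fin n) ℤ}
    (hB : IsMonomialPolyhedron B) : B.det ≠ 0 := by
  intro h0
  obtain ⟨v, hv, hv0⟩ := Matrix.exists_mulVec_eq_zero_iff.2 h0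
  have hz : ∀ j, ∑ k, (B j k : ℝ) * (v k : ℝ) = 0 := by
    intro j
    have := congrFun hv0 j
    simp only [Matrix.mulVec, dotProduct, Pi.zero_apply] at this
    exact_mod_cast this
  apply hv
  ext k
  have h1 := nonpos_of_mulVec_nonpos hB (v := fun k => (v k : ℝ)) (fun j => (hz j).le) k
  have h2 := nonpos_of_mulVec_nonpos hB (v := fun k => -(v k : ℝ))
    (fun j => by simp [hz j]) k
  simp only [Pi.zero_apply]
  have h1' : v k ≤ 0 := by exact_mod_cast h1
  have h2' : -(v k) ≤ 0 := by exact_mod_cast h2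
  omega

/-! ### The matrix A as a nonnegative integral inverse of B up to a diagonal factor -/

theorem mul_signedAdjugate {n : ℕ} (B : Matrix (Fin n) (Fin n) ℤ) :
    B * signedAdjugate B = |B.det| • (1 : Matrix (Fin n) (Fin n) ℤ) := by
  rw [signedAdjugate, Matrix.mul_smul, Matrix.mul_adjugate, smul_smul, Int.sign_mul_self_eq_abs]

/-- B maps the l-th column to |det B| times a unit vector, so the negated column is a recession
direction. -/
theorem signedAdjugate_nonneg {n : ℕ} {B : Matrix (Fin n) (Fin n) ℤ}
    (hB : IsMonomialPolyhedron B) (i l : Fin n) : 0 ≤ signedAdjugate B i l := by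
  have h := nonpos_of_mulVec_nonpos hB (v := fun k => -(signedAdjugate B k l : ℝ)) (fun j => by
    have h1 := congrFun (congrFun (mul_signedAdjugate B) j) l
    rw [Matrix.mul_apply] at h1
    have h2 : 0 ≤ ∑ k, B j k * signedAdjugate B k l := by
      rw [h1, Matrix.smul_apply, Matrix.one_apply]
      split_ifs <;> simp
    have h3 : (0 : ℝ) ≤ ∑ k, (B j k : ℝ) * (signedAdjugate B k l : ℝ) := by exact_mod_cast h2
    simp only [mul_neg, Finset.sum_neg_distrib]
    linarith) i
  have : (0 : ℝ) ≤ signedAdjugate B i l := by linarith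
  exact_mod_cast this

theorem exists_mul_matrixA_eq_diagonal {n : ℕ} {B : Matrix (Fin n) (Fin n) ℤ}
    (hB : IsMonomialPolyhedron B) :
    ∃ d : Fin n → ℤ, (∀ l, 0 < d l) ∧ B * matrixA B = Matrix.diagonal d ∧
      ∀ i l, 0 ≤ matrixA B i l := by
  set g : Fin n → ℤ := fun l => Finset.univ.gcd (fun i => signedAdjugate B i l) with hg
  have hdet : 0 < |B.det| := abs_pos.2 (det_ne_zero_of_isMonomialPolyhedron hB)
  have hgA : ∀ i l, matrixA B i l * g l = signedAdjugate B i l := fun i l =>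
    Int.ediv_mul_cancel (Finset.gcd_dvd (Finset.mem_univ i))
  have hg0 : ∀ l, 0 ≤ g l := fun l =>
    Int.nonneg_of_normalize_eq_self Finset.normalize_gcd
  have hBA : ∀ j l, (B * matrixA B) j l * g l = if j = l then |B.det| else 0 := by
    intro j l
    have h1 := congrFun (congrFun (mul_signedAdjugate B) j) l
    rw [Matrix.mul_apply, Matrix.smul_apply, Matrix.one_apply] at h1
    rw [Matrix.mul_apply, Finset.sum_mul]
    simp only [mul_assoc, hgA, h1]
    split_ifs <;> simp
  have hgpos : ∀ l, 0 < g l := fun l => by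
    refine lt_of_le_of_ne (hg0 l) fun h => ?_
    have := hBA l l
    rw [← h, mul_zero, if_pos rfl] at this
    omega
  refine ⟨fun l => (B * matrixA B) l l, fun l => ?_, ?_, fun i l => ?_⟩
  · have := hBA l l
    rw [if_pos rfl] at this
    exact pos_of_mul_pos_left (this ▸ hdet) (hg0 l)
  · ext j l
    rw [Matrix.diagonal_apply]
    split_ifs with h
    · rw [h]
    · have := hBA j l
      rw [if_neg h] at this
      exact (mul_eq_zero.1 this).resolve_right (hgpos l).ne'
  · have := signedAdjugate_nonneg hB i l
    rw [← hgA] at this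
    exact nonneg_of_mul_nonneg_left this (hgpos l)

/-! ### Consequences of BA = diag(d): column sums, invariant monomials, holomorphy -/

section DiagonalProduct

variable {n : ℕ} {B : Matrix (Fin n) (Fin n) ℤ} {d : Fin n → ℤ}

theorem sum_mul_matrixA (hBA : B * matrixA B = Matrix.diagonal d) (j l : Fin n) :
    ∑ i, B j i * matrixA B i l = if j = l then d j else 0 := by
  rw [← Matrix.mul_apply, hBA, Matrix.diagonal_apply]

theorem det_matrixA_ne_zero (hd : ∀ l, 0 < d l) (hBA : B * matrixA B = Matrix.diagonal d) :
    (matrixA B).det ≠ 0 := by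
  intro h
  have h1 := congrArg Matrix.det hBA
  rw [Matrix.det_mul, h, mul_zero, Matrix.det_diagonal] at h1
  exact (Finset.prod_pos fun l _ => hd l).ne h1

/-- diag(d)⁻¹B is a left inverse of A, hence for square matrices also a right inverse. -/
theorem sum_matrixA_mul_inv_mul (hd : ∀ l, 0 < d l)
    (hBA : B * matrixA B = Matrix.diagonal d) (i k : Fin n) :
    ∑ l, (matrixA B i l : ℝ) * ((d l : ℝ)⁻¹ * B l k) = if i = k then 1 else 0 := by
  set f : Matrix (Fin n) (Fin n) ℤ →+* Matrix (Fin n) (Fin n) ℝ :=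
    (Int.castRingHom ℝ).mapMatrix
  have h1 : (Matrix.diagonal (fun l => (d l : ℝ)⁻¹) * f B) * f (matrixA B) = 1 := by
    rw [mul_assoc, ← map_mul, hBA]
    ext i k
    simp only [f, Matrix.diagonal_mul, RingHom.mapMatrix_apply, Matrix.map_apply,
      Matrix.diagonal_apply, Matrix.one_apply]
    split_ifs with h
    · subst h
      have : (d i : ℝ) ≠ 0 := by exact_mod_cast (hd i).ne'
      simpa using inv_mul_cancel₀ this
    · simp
  have h1' := mul_eq_one_comm.1 h1
  have h2 := congrFun (congrFun h1' i) k
  rw [Matrix.mul_apply, Matrix.one_apply] at h2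
  rw [← h2]
  refine Finset.sum_congr rfl fun l _ => ?_
  simp [f, Matrix.diagonal_mul]

theorem one_le_colSum (hd : ∀ l, 0 < d l) (hBA : B * matrixA B = Matrix.diagonal d)
    (hA : ∀ i l, 0 ≤ matrixA B i l) (l : Fin n) : 1 ≤ colSum B l := by
  by_contra! h
  have h0 : ∑ i, matrixA B i l = 0 :=
    le_antisymm (Int.lt_add_one_iff.1 h) (Finset.sum_nonneg fun i _ => hA i l)
  have h1 := (Finset.sum_eq_zero_iff_of_nonneg fun i _ => hA i l).1 h0
  have h2 := sum_mul_matrixA hBA l l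
  rw [if_pos rfl, Finset.sum_eq_zero fun i hi => by rw [h1 i hi, mul_zero]] at h2
  exact (hd l).ne h2

/-- Nonnegative integer columns of sum 1 are unit vectors, so A is a permutation matrix and the
inequalities reduce to |z_{π j}|^{d_j} < 1. Excluding the polydisc therefore forces κ > 1. -/
theorem monomialDomain_eq_unitPolydisc (hd : ∀ l, 0 < d l)
    (hBA : B * matrixA B = Matrix.diagonal d) (hA : ∀ i l, 0 ≤ matrixA B i l)
    (h1 : ∀ l, colSum B l = 1) : monomialDomain B = unitPolydisc n := by
  have hunit : ∀ l, ∃ i, ∀ k, matrixA B k l = if k = i then 1 else 0 := by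
    intro l
    obtain ⟨i, -, hi⟩ : ∃ i ∈ Finset.univ, 0 < matrixA B i l := by
      apply Finset.exists_lt_of_sum_lt (f := fun _ => (0 : ℤ))
      have := h1 l
      simp only [colSum] at this
      simp [this]
    have hsum := h1 l
    rw [colSum, ← Finset.add_sum_erase _ _ (Finset.mem_univ i)] at hsum
    have hn : 0 ≤ ∑ k ∈ Finset.univ.erase i, matrixA B k l := Finset.sum_nonneg fun k _ => hA k l
    have hz : ∑ k ∈ Finset.univ.erase i, matrixA B k l = 0 := by omega
    have hz' := (Finset.sum_eq_zero_iff_of_nonneg fun k _ => hA k l).1 hz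
    refine ⟨i, fun k => ?_⟩
    split_ifs with hk
    · subst hk; omega
    · exact hz' k (Finset.mem_erase.2 ⟨hk, Finset.mem_univ k⟩)
  choose π hπ using hunit
  have hBπ : ∀ j l, B j (π l) = if j = l then d j else 0 := by
    intro j l
    rw [← sum_mul_matrixA hBA]
    simp [hπ]
  have hinj : Function.Injective π := by
    intro l l' h
    by_contra hne
    have h2 := hBπ l l'
    rw [← h, hBπ l l, if_pos rfl, if_neg hne] at h2
    exact (hd l).ne' h2
  have hsurj := Finite.surjective_of_injective hinj
  ext z
  have hprod : ∀ j, ∏ k, ‖z k‖ ^ B j k = ‖z (π j)‖ ^ d j := by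
    intro j
    rw [Finset.prod_eq_single (π j)]
    · rw [hBπ, if_pos rfl]
    · intro k _ hk
      obtain ⟨l, rfl⟩ := hsurj k
      rw [hBπ, if_neg (fun h => hk (by rw [h])), zpow_zero]
    · simp
  have hneg : ∀ j k, ¬ B j k < 0 := by
    intro j k
    obtain ⟨l, rfl⟩ := hsurj k
    rw [hBπ]
    split_ifs <;> simp [(hd j).le]
  have hiff : ∀ j, ‖z (π j)‖ ^ d j < 1 ↔ ‖z (π j)‖ < 1 := by
    intro j
    obtain ⟨m, hm⟩ := Int.eq_ofNat_of_zero_le (hd j).le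
    have hm0 : m ≠ 0 := by have := hd j; omega
    rw [hm, zpow_natCast, pow_lt_one_iff_of_nonneg (norm_nonneg _) hm0]
  constructor
  · intro hz k
    obtain ⟨l, rfl⟩ := hsurj k
    exact (hiff l).1 ((hprod l) ▸ (hz l).2)
  · intro hz j
    exact ⟨fun k hk => absurd hk (hneg j k), by rw [hprod, hiff]; exact hz _⟩

theorem pStar_eq (hσ : ∀ l, 1 ≤ colSum B l) {j : Fin n} (hj : ∀ l, colSum B l ≤ colSum B j) :
    pStar B = 2 * (colSum B j : ℝ) / ((colSum B j : ℝ) + 1) := by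
  have : Nonempty (Fin n) := ⟨j⟩
  refine le_antisymm (ciSup_le fun l => ?_)
    (le_ciSup (f := fun j => 2 * (colSum B j : ℝ) / ((colSum B j : ℝ) + 1))
      (Set.finite_range _).bddAbove j)
  have h1 : (1 : ℝ) ≤ colSum B l := by exact_mod_cast hσ l
  have h2 : (colSum B l : ℝ) ≤ colSum B j := by exact_mod_cast hj l
  rw [div_le_div_iff₀ (by linarith) (by linarith)]
  nlinarith

/-- Under σ_ν the monomial is multiplied by exp(2πi bA⁻¹ν). Invariance at a single point where it
does not vanish, for the unit vectors ν, makes bA⁻¹ integral. -/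
theorem exists_vecMul_eq_of_isDeckInvariant (hd : ∀ l, 0 < d l)
    (hBA : B * matrixA B = Matrix.diagonal d) {b : Fin n → ℤ} (hb : IsDeckInvariant B (monomial b)) :
    ∃ γ : Fin n → ℤ, ∀ l, ∑ i, γ i * matrixA B i l = b l := by
  set AC := (matrixA B).map (Int.cast : ℤ → ℂ) with hAC
  have hdet : IsUnit AC.det := by
    have : AC.det = ((matrixA B).det : ℂ) := ((Int.castRingHom ℂ).map_det (matrixA B)).symm
    rw [this, isUnit_iff_ne_zero]
    exact_mod_cast det_matrixA_ne_zero hd hBA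
  -- All logarithms equal −1, so the point has nonzero coordinates and lies over the interior of the
  -- negative orthant.
  set z : Fin n → ℂ := fun _ => (Real.exp (-1) : ℂ) with hz
  have hz0 : ∀ k, z k ≠ 0 := fun k => by
    simp only [hz]; exact_mod_cast (Real.exp_pos _).ne'
  have hzΩ : z ∈ coveringPolydisc B := by
    constructor
    · intro k
      simp only [hz, Complex.norm_real, Real.norm_eq_abs, Real.abs_exp, Real.exp_lt_one_iff]
      norm_num
    · have hc0 : ∀ i, coveringMap B z i ≠ 0 := fun i => by
        rw [coveringMap, monomial]
        exact Finset.prod_ne_zero_iff.2 fun k _ => zpow_ne_zero _ (hz0 k)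
      rw [mem_monomialDomain_iff B hc0]
      have hlog : ∀ i, Real.log ‖coveringMap B z i‖ = -∑ l, (matrixA B i l : ℝ) := by
        intro i
        rw [coveringMap, norm_monomial, prod_norm_zpow_eq_exp _ hz0, Real.log_exp,
          ← Finset.sum_neg_distrib]
        refine Finset.sum_congr rfl fun l _ => ?_
        simp [hz, Complex.norm_real, Real.abs_exp, -Complex.ofReal_exp]
      intro j
      simp only [hlog]
      have h1 : ∑ i, (B j i : ℝ) * -∑ l, (matrixA B i l : ℝ)
          = -∑ l, ((∑ i, B j i * matrixA B i l : ℤ) : ℝ) := by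
        push_cast
        rw [Finset.sum_comm]
        simp only [mul_neg, Finset.sum_neg_distrib, Finset.mul_sum]
      rw [h1]
      simp only [sum_mul_matrixA hBA, Int.cast_ite, Int.cast_zero, Finset.sum_ite_eq,
        Finset.mem_univ, if_true]
      have := hd j
      simpa using this
  have hint : ∀ i, ∃ m : ℤ, ∑ j, (b j : ℂ) * AC⁻¹ j i = m := by
    intro i
    have h1 := hb (Pi.single i 1) z hzΩ
    have h2 : ∀ j, deckTransformation B (Pi.single i 1) z j
        = Complex.exp (2 * Real.pi * Complex.I * AC⁻¹ j i) * z j := by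
      intro j
      simp only [deckTransformation]
      congr 3
      rw [Finset.sum_eq_single i] <;> simp +contextual [hAC]
    have h3 : monomial b (deckTransformation B (Pi.single i 1) z)
        = Complex.exp (2 * Real.pi * Complex.I * ∑ j, (b j : ℂ) * AC⁻¹ j i) * monomial b z := by
      simp only [monomial, h2, mul_zpow, Finset.prod_mul_distrib, Finset.mul_sum,
        Complex.exp_sum]
      congr 1
      refine Finset.prod_congr rfl fun j _ => ?_
      rw [← Complex.exp_int_mul]
      congr 1; ring
    rw [h3] at h1
    have h4 : monomial b z ≠ 0 := Finset.prod_ne_zero_iff.2 fun k _ => zpow_ne_zero _ (hz0 k)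
    obtain ⟨m, hm⟩ := Complex.exp_eq_one_iff.1 (mul_right_cancel₀ h4 (h1.trans (one_mul _).symm))
    refine ⟨m, ?_⟩
    have h5 : (2 * Real.pi * Complex.I : ℂ) ≠ 0 := Complex.two_pi_I_ne_zero
    rw [mul_comm (m : ℂ)] at hm
    exact mul_left_cancel₀ h5 hm
  choose γ hγ using hint
  refine ⟨γ, fun l => ?_⟩
  have h6 : Matrix.vecMul (Matrix.vecMul (fun j => (b j : ℂ)) AC⁻¹) AC = fun j => (b j : ℂ) := by
    rw [Matrix.vecMul_vecMul, Matrix.nonsing_inv_mul _ hdet, Matrix.vecMul_one]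
  have h7 : Matrix.vecMul (fun j => (b j : ℂ)) AC⁻¹ = fun i => (γ i : ℂ) := by
    ext i; rw [← hγ i]; rfl
  rw [h7] at h6
  have h8 := congrFun h6 l
  simp only [Matrix.vecMul, dotProduct, hAC, Matrix.map_apply] at h8
  exact_mod_cast h8

/-- The monomial that is the test function: in the coordinates of the covering polydisc, together
with the Jacobian factor, it has nonnegative exponents, which vanish at `j` and `k`. -/
theorem exists_critical_exponent (hd : ∀ l, 0 < d l)
    (hBA : B * matrixA B = Matrix.diagonal d) {b : Fin n → ℤ} (hb : IsDeckInvariant B (monomial b))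
    {j k : Fin n} (hbj : b j = 1) (hbk : b k = 1) :
    ∃ β b' : Fin n → ℤ, (∀ l, ∑ i, β i * matrixA B i l = b' l - colSum B l) ∧
      (∀ l, 1 ≤ b' l) ∧ b' j = 1 ∧ b' k = 1 := by
  obtain ⟨γ, hγ⟩ := exists_vecMul_eq_of_isDeckInvariant hd hBA hb
  -- Adding N_l times row l of B to γ raises only the l-th exponent, by N_l d_l. Since d_l ≥ 1, the
  -- value |b_l| + 1 makes it at least 1, while 0 preserves the exponents at j and k. The −1 in the
  -- witness β accounts for the column sums.
  set N : Fin n → ℤ := fun l => if l = j ∨ l = k then 0 else |b l| + 1 with hN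
  refine ⟨fun i => γ i + ∑ l, N l * B l i - 1, fun l => b l + N l * d l, fun l => ?_,
    fun l => ?_, by simp [hN, hbj], by simp [hN, hbk]⟩
  · have h1 : ∑ i, (∑ m, N m * B m i) * matrixA B i l = N l * d l := by
      simp only [Finset.sum_mul, mul_assoc]
      rw [Finset.sum_comm]
      simp only [← Finset.mul_sum, sum_mul_matrixA hBA]
      simp
    simp only [sub_mul, add_mul, Finset.sum_sub_distrib, Finset.sum_add_distrib, h1, hγ, one_mul,
      colSum]
  · by_cases h : l = j ∨ l = k
    · rcases h with rfl | rfl <;> simp [hN, hbj, hbk]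
    · simp only [hN, if_neg h]
      have h1 := hd l
      have h2 := neg_abs_le (b l)
      nlinarith [abs_nonneg (b l)]

/-- Since β + 𝟙 = b'A⁻¹ and A⁻¹ = diag(d)⁻¹B, the entry β_k + 1 is a combination of column k of B
with positive coefficients. That column is nonzero, so the integer β_k + 1 is positive. This gives
holomorphy across z_k = 0 when no exponent forbids that hyperplane. -/
theorem nonneg_of_column_nonneg (hd : ∀ l, 0 < d l)
    (hBA : B * matrixA B = Matrix.diagonal d)
    {β b' : Fin n → ℤ} (hβ : ∀ l, ∑ i, β i * matrixA B i l = b' l - colSum B l)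
    (hb' : ∀ l, 1 ≤ b' l) {k : Fin n} (hk : ∀ l, 0 ≤ B l k) : 0 ≤ β k := by
  have h1 : ∀ l, ∑ i, ((β i : ℝ) + 1) * matrixA B i l = b' l := by
    intro l
    have := hβ l
    have h2 : ∑ i, (β i + 1) * matrixA B i l = b' l := by
      simp only [add_mul, Finset.sum_add_distrib, this, one_mul, colSum]; ring
    exact_mod_cast h2
  have h2 : ((β k : ℝ) + 1) = ∑ l, (b' l : ℝ) * ((d l : ℝ)⁻¹ * B l k) := by
    simp only [← h1, Finset.sum_mul, mul_assoc]
    rw [Finset.sum_comm]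
    simp only [← Finset.mul_sum, sum_matrixA_mul_inv_mul hd hBA]
    simp
  have hterm : ∀ l, 0 ≤ (b' l : ℝ) * ((d l : ℝ)⁻¹ * B l k) := fun l => by
    have h3 : (0 : ℝ) ≤ b' l := by exact_mod_cast (by linarith [hb' l] : 0 ≤ b' l)
    have h4 : (0 : ℝ) ≤ d l := by exact_mod_cast (hd l).le
    have h5 : (0 : ℝ) ≤ B l k := by exact_mod_cast hk l
    positivity
  have hne : (β k : ℝ) + 1 ≠ 0 := by
    intro h0
    rw [h0] at h2
    have h3 := (Finset.sum_eq_zero_iff_of_nonneg fun l _ => hterm l).1 h2.symm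
    have h4 := sum_matrixA_mul_inv_mul hd hBA k k
    rw [if_pos rfl, Finset.sum_eq_zero] at h4
    · exact zero_ne_one h4
    · intro l hl
      have h5 : (b' l : ℝ) ≠ 0 := by
        have := hb' l
        exact_mod_cast (by omega : b' l ≠ 0)
      rw [(mul_eq_zero.1 (h3 l hl)).resolve_left h5, mul_zero]
  have h3 : 0 < (β k : ℝ) + 1 :=
    lt_of_le_of_ne (h2 ▸ Finset.sum_nonneg fun l _ => hterm l) hne.symm
  have h4 : 0 < β k + 1 := by exact_mod_cast h3
  omega

end DiagonalProduct

/-! ### Integration of functions of the moduli in logarithmic coordinates -/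

theorem lintegral_pi_prod {n : ℕ} (μ : Fin n → Measure ℝ) [∀ i, SigmaFinite (μ i)]
    {f : Fin n → ℝ → ENNReal} (hf : ∀ i, Measurable (f i)) :
    ∫⁻ x, ∏ i, f i (x i) ∂Measure.pi μ = ∏ i, ∫⁻ x, f i x ∂μ i := by
  induction n with
  | zero => simp
  | succ n ih =>
    have hmp := (measurePreserving_piFinSuccAbove μ 0).symm
    rw [← hmp.lintegral_comp_emb (MeasurableEquiv.measurableEmbedding _), Fin.prod_univ_succ]
    simp only [MeasurableEquiv.piFinSuccAbove_symm_apply, Fin.insertNthEquiv_zero,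
      Fin.prod_univ_succ, Fin.consEquiv_apply, Fin.cons_zero, Fin.cons_succ]
    rw [lintegral_prod_mul (f := f 0) (g := fun y : Fin n → ℝ => ∏ i, f i.succ (y i))
      (hf 0).aemeasurable (Finset.measurable_prod _ fun i _ =>
        (hf i.succ).comp (measurable_pi_apply i)).aemeasurable]
    congr 1
    exact ih (fun i => μ i.succ) fun i => hf i.succ

/-- The image of Lebesgue measure on `ℂ` under `z ↦ log ‖z‖`. -/
noncomputable def logMeasure : Measure ℝ :=
  volume.withDensity fun t => ENNReal.ofReal (2 * Real.pi * Real.exp (2 * t))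

/-- Polar coordinates with r = e^t: one factor e^t is the polar Jacobian, the other is dr/dt, and
the angle contributes 2π. -/
theorem lintegral_comp_log_norm (f : ℝ → ENNReal) (hf : Measurable f) :
    ∫⁻ z : ℂ, f (Real.log ‖z‖) =
      ∫⁻ t, ENNReal.ofReal (2 * Real.pi * Real.exp (2 * t)) * f t := by
  rw [← Complex.lintegral_comp_polarCoord_symm]
  have h1 : ∀ p ∈ polarCoord.target,
      ENNReal.ofReal p.1 • f (Real.log ‖Complex.polarCoord.symm p‖)
        = ENNReal.ofReal p.1 * f (Real.log p.1) := by
    intro p hp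
    rw [polarCoord_target] at hp
    rw [Complex.norm_polarCoord_symm, abs_of_pos hp.1, smul_eq_mul]
  have hm : Measurable fun r : ℝ => ENNReal.ofReal r * f (Real.log r) :=
    ENNReal.measurable_ofReal.mul (hf.comp Real.measurable_log)
  rw [setLIntegral_congr_fun polarCoord.open_target.measurableSet h1, polarCoord_target,
    Measure.volume_eq_prod, ← Measure.prod_restrict,
    lintegral_prod (fun x : ℝ × ℝ => ENNReal.ofReal x.1 * f (Real.log x.1))
      (hm.comp measurable_fst).aemeasurable]
  simp only [lintegral_const, Measure.restrict_apply MeasurableSet.univ, Set.univ_inter,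
    Real.volume_Ioo]
  have h2 : Set.Ioi (0 : ℝ) = Real.exp '' Set.univ := by
    rw [Set.image_univ, Real.range_exp]
  rw [h2, lintegral_image_eq_lintegral_abs_deriv_mul MeasurableSet.univ
    (fun x _ => (Real.hasDerivAt_exp x).hasDerivWithinAt) Real.exp_injective.injOn,
    Measure.restrict_univ]
  refine lintegral_congr fun t => ?_
  rw [Real.abs_exp, Real.log_exp, show (2 : ℝ) * Real.pi * Real.exp (2 * t)
    = Real.exp t * Real.exp t * (Real.pi - -Real.pi) by rw [← Real.exp_add]; ring_nf,
    ENNReal.ofReal_mul (by positivity), ENNReal.ofReal_mul (by positivity)]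
  ring

theorem measurable_ofReal_two_pi_exp :
    Measurable fun t : ℝ => ENNReal.ofReal (2 * Real.pi * Real.exp (2 * t)) := by fun_prop

instance : SigmaFinite logMeasure := by
  unfold logMeasure
  exact SigmaFinite.withDensity_ofReal _

theorem measurePreserving_log_norm :
    MeasurePreserving (fun z : ℂ => Real.log ‖z‖) volume logMeasure := by
  have hm : Measurable fun z : ℂ => Real.log ‖z‖ := by fun_prop
  refine ⟨hm, Measure.ext fun s hs => ?_⟩
  rw [← lintegral_indicator_one hs, lintegral_map (measurable_one.indicator hs) hm,
    lintegral_comp_log_norm _ (measurable_one.indicator hs), logMeasure,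
    withDensity_apply _ hs, ← lintegral_indicator hs]
  refine lintegral_congr fun t => ?_
  by_cases ht : t ∈ s <;> simp [ht]

/-- The coordinatewise logarithm of the absolute values. -/
noncomputable def logNorm {n : ℕ} (z : Fin n → ℂ) : Fin n → ℝ := fun k => Real.log ‖z k‖

theorem pi_logMeasure (n : ℕ) : Measure.pi (fun _ : Fin n => logMeasure) =
    volume.withDensity fun t => ∏ k, ENNReal.ofReal (2 * Real.pi * Real.exp (2 * t k)) := by
  refine Measure.pi_eq fun s hs => ?_
  have hS := MeasurableSet.univ_pi hs
  rw [withDensity_apply _ hS, volume_pi, Measure.restrict_pi_pi,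
    lintegral_pi_prod _ fun _ => measurable_ofReal_two_pi_exp]
  refine Finset.prod_congr rfl fun i _ => ?_
  rw [logMeasure, withDensity_apply _ (hs i)]

theorem lintegral_comp_logNorm {n : ℕ} {f : (Fin n → ℝ) → ENNReal} (hf : Measurable f) :
    ∫⁻ z : Fin n → ℂ, f (logNorm z) =
      ∫⁻ t, ENNReal.ofReal ((2 * Real.pi) ^ n * Real.exp (2 * ∑ k, t k)) * f t := by
  have h := measurePreserving_pi (fun _ : Fin n => (volume : Measure ℂ)) (fun _ => logMeasure)
    fun _ => measurePreserving_log_norm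
  have h1 := h.lintegral_comp hf
  rw [← volume_pi] at h1
  refine h1.trans ?_
  rw [pi_logMeasure, lintegral_withDensity_eq_lintegral_mul _ (by fun_prop) hf]
  refine lintegral_congr fun t => ?_
  rw [Pi.mul_apply, ← ENNReal.ofReal_prod_of_nonneg fun _ _ => by positivity,
    Finset.prod_mul_distrib, ← Real.exp_sum, Finset.mul_sum]
  simp

theorem ae_forall_ne_zero (n : ℕ) : ∀ᵐ z : Fin n → ℂ, ∀ k, z k ≠ 0 := by
  rw [ae_all_iff]
  intro k
  rw [ae_iff]
  have := Measure.pi_hyperplane (fun _ : Fin n => (volume : Measure ℂ)) k 0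
  rw [← volume_pi] at this
  simpa using this

theorem measurableSet_monomialDomain {n : ℕ} (B : Matrix (Fin n) (Fin n) ℤ) :
    MeasurableSet (monomialDomain B) := by
  have : monomialDomain B = ⋂ j, ((⋂ k, {z | B j k < 0 → z k ≠ 0}) ∩
      {z | ∏ k, ‖z k‖ ^ B j k < 1}) := by
    ext z; simp [monomialDomain]
  rw [this]
  refine MeasurableSet.iInter fun j => (MeasurableSet.iInter fun k => ?_).inter ?_
  · by_cases h : B j k < 0
    · have := measurable_pi_apply (X := fun _ : Fin n => ℂ) k
        (measurableSet_singleton (0 : ℂ)).compl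
      simp only [h, true_imp_iff]
      exact this
    · simp [h]
  · refine measurableSet_lt (Finset.measurable_prod _ fun k _ => ?_) measurable_const
    exact (measurable_pi_apply k).norm.pow_const _

theorem measurableSet_logCone {n : ℕ} (B : Matrix (Fin n) (Fin n) ℤ) :
    MeasurableSet (logCone B) := by
  have : logCone B = ⋂ j, {t | ∑ k, (B j k : ℝ) * t k < 0} := by
    ext t; simp [logCone]
  rw [this]
  exact MeasurableSet.iInter fun j => measurableSet_lt (by fun_prop) measurable_const

/-! ### The linear change of variables t = As -/

section CoveringCoordinates

variable {n : ℕ} {B : Matrix (Fin n) (Fin n) ℤ} {d : Fin n → ℤ}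

theorem sum_mul_sum_matrixA (x : Fin n → ℝ) (s : Fin n → ℝ) :
    ∑ i, x i * ∑ l, (matrixA B i l : ℝ) * s l = ∑ l, (∑ i, x i * matrixA B i l) * s l := by
  simp only [Finset.mul_sum, Finset.sum_mul, mul_assoc]
  rw [Finset.sum_comm]

theorem matrixA_mem_logCone_iff (hd : ∀ l, 0 < d l)
    (hBA : B * matrixA B = Matrix.diagonal d) (s : Fin n → ℝ) :
    (fun i => ∑ l, (matrixA B i l : ℝ) * s l) ∈ logCone B ↔ ∀ l, s l < 0 := by
  refine forall_congr' fun j => ?_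
  have h : ∀ l, ∑ i, (B j i : ℝ) * (matrixA B i l : ℝ) = if j = l then (d j : ℝ) else 0 := by
    intro l
    exact_mod_cast sum_mul_matrixA hBA j l
  rw [sum_mul_sum_matrixA (fun i => (B j i : ℝ)) s]
  have hdj : (0 : ℝ) < d j := by exact_mod_cast hd j
  simp only [h, ite_mul, zero_mul, Finset.sum_ite_eq, Finset.mem_univ, if_true]
  exact ⟨fun h => by by_contra! h'; exact absurd h (not_lt.2 (by positivity)),
    fun h => mul_neg_of_pos_of_neg hdj h⟩

/-- Integration of functions of `‖z k‖` over the domain, in the logarithmic coordinates of the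
covering polydisc. -/
theorem lintegral_monomialDomain (hd : ∀ l, 0 < d l)
    (hBA : B * matrixA B = Matrix.diagonal d) {f : (Fin n → ℝ) → ENNReal} (hf : Measurable f) :
    ∫⁻ z in monomialDomain B, f (logNorm z) =
      ENNReal.ofReal (|((matrixA B).det : ℝ)| * (2 * Real.pi) ^ n) *
        ∫⁻ s in {s : Fin n → ℝ | ∀ l, s l < 0},
          ENNReal.ofReal (Real.exp (2 * ∑ l, (colSum B l : ℝ) * s l)) *
            f fun i => ∑ l, (matrixA B i l : ℝ) * s l := by
  set AR : Matrix (Fin n) (Fin n) ℝ := (matrixA B).map (Int.cast : ℤ → ℝ) with hAR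
  have hdetR : AR.det = ((matrixA B).det : ℝ) := ((Int.castRingHom ℝ).map_det (matrixA B)).symm
  have hdet : AR.det ≠ 0 := by
    rw [hdetR]; exact_mod_cast det_matrixA_ne_zero hd hBA
  have hN : MeasurableSet {s : Fin n → ℝ | ∀ l, s l < 0} := by
    simp only [Set.ofPred_forall]
    exact MeasurableSet.iInter fun l => measurableSet_lt (measurable_pi_apply l) measurable_const
  rw [← lintegral_indicator (measurableSet_monomialDomain B)]
  -- Off the null coordinate hyperplanes, membership in the domain depends only on the logarithms.
  have h1 : ∫⁻ z, (monomialDomain B).indicator (fun z => f (logNorm z)) z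
      = ∫⁻ z : Fin n → ℂ, (logCone B).indicator f (logNorm z) := by
    refine lintegral_congr_ae ?_
    filter_upwards [ae_forall_ne_zero n] with z hz
    have := mem_monomialDomain_iff B hz
    by_cases h : z ∈ monomialDomain B
    · have h' : logNorm z ∈ logCone B := this.1 h
      simp [h, h']
    · have h' : logNorm z ∉ logCone B := fun h' => h (this.2 h')
      simp [h, h']
  have hfi := hf.indicator (measurableSet_logCone B)
  rw [h1, lintegral_comp_logNorm hfi]
  set G : (Fin n → ℝ) → ENNReal := fun t =>
    ENNReal.ofReal ((2 * Real.pi) ^ n * Real.exp (2 * ∑ k, t k)) * (logCone B).indicator f t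
    with hG
  have hGm : Measurable G := Measurable.mul (by fun_prop) hfi
  have h2 : ∫⁻ t, G t = ENNReal.ofReal |AR.det| * ∫⁻ s, G (Matrix.toLin' AR s) := by
    have hm : Measurable (Matrix.toLin' AR) :=
      (LinearMap.continuous_of_finiteDimensional _).measurable
    rw [← lintegral_map hGm hm, Real.map_matrix_volume_pi_eq_smul_volume_pi hdet,
      lintegral_smul_measure, smul_eq_mul, ← mul_assoc, ← ENNReal.ofReal_mul (abs_nonneg _),
      ← abs_mul, mul_inv_cancel₀ hdet, abs_one, ENNReal.ofReal_one, one_mul]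
  have hAs : ∀ s : Fin n → ℝ, Matrix.toLin' AR s = fun i => ∑ l, (matrixA B i l : ℝ) * s l := by
    intro s
    ext i
    simp [hAR, Matrix.mulVec, dotProduct]
  rw [h2, ENNReal.ofReal_mul (abs_nonneg _), mul_assoc, hdetR]
  congr 1
  rw [← lintegral_const_mul' _ _ ENNReal.ofReal_ne_top, ← lintegral_indicator hN]
  · refine lintegral_congr fun s => ?_
    rw [hAs]
    simp only [hG]
    by_cases hs : ∀ l, s l < 0
    · rw [Set.indicator_of_mem ((matrixA_mem_logCone_iff hd hBA s).2 hs),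
        Set.indicator_of_mem (show s ∈ {s : Fin n → ℝ | ∀ l, s l < 0} from hs),
        ENNReal.ofReal_mul (by positivity), mul_assoc]
      congr 5
      -- The weight exp(2 Σ t_k) becomes exp(2 Σ (𝟙a_l) s_l), since 𝟙·As = (𝟙A)·s.
      have := sum_mul_sum_matrixA (B := B) (fun _ => 1) s
      simp only [one_mul] at this
      rw [this]
      congr 1
      ext l
      simp [colSum]
    · rw [Set.indicator_of_notMem (fun h => hs ((matrixA_mem_logCone_iff hd hBA s).1 h)),
        Set.indicator_of_notMem (show s ∉ {s : Fin n → ℝ | ∀ l, s l < 0} from hs), mul_zero]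

end CoveringCoordinates

theorem measurable_monomial {n : ℕ} (β : Fin n → ℤ) : Measurable (monomial β) := by
  unfold monomial
  exact Finset.measurable_prod _ fun k _ => (measurable_pi_apply k).pow_const _

theorem norm_monomial_eq_exp {n : ℕ} (β : Fin n → ℤ) {z : Fin n → ℂ} (hz : ∀ k, z k ≠ 0) :
    ‖monomial β z‖ = Real.exp (∑ k, (β k : ℝ) * logNorm z k) := by
  rw [norm_monomial, prod_norm_zpow_eq_exp β hz]; rfl

/-! ### Square integrability and distribution function of the critical monomial -/

section CriticalMonomial

variable {n : ℕ} {B : Matrix (Fin n) (Fin n) ℤ} {d : Fin n → ℤ} {β b' : Fin n → ℤ}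

theorem sum_exponent_mul_sum_matrixA
    (hβ : ∀ l, ∑ i, β i * matrixA B i l = b' l - colSum B l) (s : Fin n → ℝ) :
    ∑ i, (β i : ℝ) * ∑ l, (matrixA B i l : ℝ) * s l
      = ∑ l, ((b' l : ℝ) - colSum B l) * s l := by
  rw [sum_mul_sum_matrixA (fun i => (β i : ℝ))]
  refine Finset.sum_congr rfl fun l _ => ?_
  congr 1
  exact_mod_cast hβ l

/-- The weight times |z^β|² is ∏ exp(2 b'_l s_l), which is integrable over the negative orthant
because every b'_l is positive. -/
theorem memLp_monomial (hd : ∀ l, 0 < d l) (hBA : B * matrixA B = Matrix.diagonal d)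
    (hβ : ∀ l, ∑ i, β i * matrixA B i l = b' l - colSum B l) (hb' : ∀ l, 1 ≤ b' l) :
    MemLp (monomial β) 2 (volume.restrict (monomialDomain B)) := by
  have hm := (measurable_monomial β).aestronglyMeasurable (μ := volume.restrict (monomialDomain B))
  rw [memLp_two_iff_integrable_sq_norm hm]
  refine ⟨(hm.norm.pow 2), ?_⟩
  rw [hasFiniteIntegral_iff_ofReal (ae_of_all _ fun _ => by positivity)]
  have h1 : ∫⁻ z in monomialDomain B, ENNReal.ofReal (‖monomial β z‖ ^ 2)
      = ∫⁻ z in monomialDomain B,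
        (fun t : Fin n → ℝ => ENNReal.ofReal (Real.exp (2 * ∑ k, (β k : ℝ) * t k)))
          (logNorm z) := by
    refine lintegral_congr_ae (ae_restrict_of_ae ?_)
    filter_upwards [ae_forall_ne_zero n] with z hz
    rw [norm_monomial_eq_exp β hz, ← Real.exp_nat_mul]
    norm_num
  rw [h1, lintegral_monomialDomain hd hBA (f := fun t : Fin n → ℝ =>
    ENNReal.ofReal (Real.exp (2 * ∑ k, (β k : ℝ) * t k))) (by fun_prop)]
  refine ENNReal.mul_lt_top ENNReal.ofReal_lt_top ?_
  have h2 : {s : Fin n → ℝ | ∀ l, s l < 0} = Set.univ.pi fun _ => Set.Iio 0 := by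
    ext s; simp
  have h3 : ∀ s : Fin n → ℝ,
      ENNReal.ofReal (Real.exp (2 * ∑ l, (colSum B l : ℝ) * s l)) *
        ENNReal.ofReal (Real.exp (2 * ∑ k, (β k : ℝ) * ∑ l, (matrixA B k l : ℝ) * s l))
        = ∏ l, ENNReal.ofReal (Real.exp (2 * b' l * s l)) := by
    intro s
    rw [← ENNReal.ofReal_mul (Real.exp_pos _).le, ← Real.exp_add,
      ← ENNReal.ofReal_prod_of_nonneg fun _ _ => (Real.exp_pos _).le, ← Real.exp_sum,
      sum_exponent_mul_sum_matrixA hβ, ← mul_add, ← Finset.sum_add_distrib, Finset.mul_sum]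
    congr 3
    ext l; ring
  simp only [h3]
  rw [h2, volume_pi, Measure.restrict_pi_pi,
    lintegral_pi_prod (f := fun l x => ENNReal.ofReal (Real.exp (2 * b' l * x))) _
      fun l => by fun_prop]
  refine ENNReal.prod_lt_top fun l _ => ?_
  have hl : (0 : ℝ) < 2 * b' l := by
    have : (1 : ℝ) ≤ b' l := by exact_mod_cast hb' l
    linarith
  have h4 := ((integrableOn_exp_mul_Iic hl 0).mono_set Set.Iio_subset_Iic_self).2
  rwa [hasFiniteIntegral_iff_ofReal (ae_of_all _ fun _ => (Real.exp_pos _).le)] at h4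

theorem sum_mul_bounds_of_mem_box {x a s : Fin n → ℝ}
    (hs : s ∈ Set.univ.pi fun l => Set.Ioo (a l - 1) (a l)) :
    ∑ l, x l * a l - ∑ l, |x l| ≤ ∑ l, x l * s l := by
  rw [← Finset.sum_sub_distrib]
  refine Finset.sum_le_sum fun l _ => ?_
  have h1 := hs l (Set.mem_univ l)
  have h2 : |x l * (s l - a l)| ≤ |x l| := by
    rw [abs_mul]
    refine mul_le_of_le_one_right (abs_nonneg _) ?_
    rw [abs_le]
    constructor <;> linarith [h1.1, h1.2]
  nlinarith [neg_abs_le (x l * (s l - a l))]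

/-- The corners of pairwise disjoint unit boxes near the hyperplane `s j + s k = -N`. -/
noncomputable def boxCorner (j k : Fin n) (N i : ℕ) (l : Fin n) : ℝ :=
  if l = j then -(i : ℝ) else if l = k then -((N : ℝ) - i) else 0

/-- Equal coefficients at j and k make the functional independent of i: modulus and weight are
comparable across all the boxes. -/
theorem sum_mul_boxCorner {j k : Fin n} (hjk : j ≠ k) {x : Fin n → ℝ} (hx : x j = x k)
    (N i : ℕ) : ∑ l, x l * boxCorner j k N i l = -(x j * N) := by
  have h : ∀ l, x l * boxCorner j k N i l
      = (if l = j then -(x j * i) else 0) + if l = k then -(x j * (N - i)) else 0 := by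
    intro l
    unfold boxCorner
    by_cases h1 : l = j
    · subst h1; simp [hjk]
    · by_cases h2 : l = k
      · subst h2; simp [h1, hx]; ring
      · simp [h1, h2]
  simp only [h, Finset.sum_add_distrib, Finset.sum_ite_eq', Finset.mem_univ, if_true]
  ring

/-- The critical monomial is not in weak `L^q` for the critical exponent: its distribution function
carries an additional factor `N`, which is logarithmic in the level. -/
theorem exists_distribution_lower_bound (hd : ∀ l, 0 < d l)
    (hBA : B * matrixA B = Matrix.diagonal d)
    (hβ : ∀ l, ∑ i, β i * matrixA B i l = b' l - colSum B l) {j k : Fin n} (hjk : j ≠ k)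
    (hσ : colSum B j = colSum B k) (hbj : b' j = 1) (hbk : b' k = 1) :
    ∃ c M : ℝ, 0 < c ∧ ∀ N : ℕ,
      ENNReal.ofReal (c * (N * Real.exp (-(2 * colSum B j * N)))) ≤
        volume.restrict (monomialDomain B)
          {z | Real.exp (((colSum B j : ℝ) - 1) * N - M) < ‖monomial β z‖} := by
  set C₀ : ℝ := |((matrixA B).det : ℝ)| * (2 * Real.pi) ^ n with hC₀
  have hC₀pos : 0 < C₀ := by
    have : ((matrixA B).det : ℝ) ≠ 0 := by exact_mod_cast det_matrixA_ne_zero hd hBA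
    positivity
  set S : ℝ := ∑ l, |(colSum B l : ℝ)| with hS
  -- The sum bounds the variation of log|z^β| over a unit box; the extra 1 makes the level
  -- inequality strict.
  set M : ℝ := ∑ l, |(b' l : ℝ) - colSum B l| + 1 with hM
  refine ⟨C₀ * Real.exp (-(2 * S)), M, by positivity, fun N => ?_⟩
  set L : ℝ := ((colSum B j : ℝ) - 1) * N - M with hL
  set D : Set (Fin n → ℝ) := {t | L < ∑ i, (β i : ℝ) * t i} with hD
  have hDm : MeasurableSet D := measurableSet_lt measurable_const (by fun_prop)
  have hlevel : MeasurableSet {z : Fin n → ℂ | Real.exp L < ‖monomial β z‖} :=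
    measurableSet_lt measurable_const (measurable_monomial β).norm
  have h1 : volume.restrict (monomialDomain B) {z | Real.exp L < ‖monomial β z‖}
      = ∫⁻ z in monomialDomain B, D.indicator 1 (logNorm z) := by
    rw [← lintegral_indicator_one hlevel]
    refine lintegral_congr_ae (ae_restrict_of_ae ?_)
    filter_upwards [ae_forall_ne_zero n] with z hz
    have : Real.exp L < ‖monomial β z‖ ↔ logNorm z ∈ D := by
      rw [norm_monomial_eq_exp β hz, Real.exp_lt_exp]; rfl
    by_cases h : logNorm z ∈ D
    · have h' := this.2 h
      simp [h, h']
    · have h' : z ∉ {z : Fin n → ℂ | Real.exp L < ‖monomial β z‖} := fun h'' => h (this.1 h'')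
      rw [Set.indicator_of_notMem h, Set.indicator_of_notMem h']
  rw [h1, lintegral_monomialDomain hd hBA (measurable_one.indicator hDm)]
  set box : ℕ → Set (Fin n → ℝ) := fun i =>
    Set.univ.pi fun l => Set.Ioo (boxCorner j k N i l - 1) (boxCorner j k N i l) with hbox
  have hboxm : ∀ i, MeasurableSet (box i) := fun i =>
    MeasurableSet.univ_pi fun _ => measurableSet_Ioo
  have hvol : ∀ i, volume (box i) = 1 := by
    intro i
    rw [hbox, Real.volume_pi_Ioo]
    simp
  -- The j-th sides (−i−1, −i) are already disjoint, so the N boxes contribute additively; this is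
  -- the source of the factor N.
  have hdisj : Set.PairwiseDisjoint (Finset.range N : Set ℕ) box := by
    intro i _ i' _ hne
    rw [Function.onFun, Set.disjoint_left]
    intro s hs hs'
    have e := hs j (Set.mem_univ j)
    have e' := hs' j (Set.mem_univ j)
    simp only [boxCorner, if_true, Set.mem_Ioo] at e e'
    have e1 : (i : ℝ) < i' + 1 := by linarith [e.1, e'.2]
    have e2 : (i' : ℝ) < i + 1 := by linarith [e'.1, e.2]
    have e1' : i < i' + 1 := by exact_mod_cast e1
    have e2' : i' < i + 1 := by exact_mod_cast e2
    omega
  have hsub : (⋃ i ∈ Finset.range N, box i) ⊆ {s : Fin n → ℝ | ∀ l, s l < 0} := by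
    intro s hs l
    simp only [Set.mem_iUnion] at hs
    obtain ⟨i, hi, hs⟩ := hs
    have hiN : (i : ℝ) ≤ N := by exact_mod_cast (Finset.mem_range.1 hi).le
    refine (hs l (Set.mem_univ l)).2.trans_le ?_
    unfold boxCorner
    split_ifs
    · simp
    · linarith
    · exact le_rfl
  have hpt : ∀ i, ∀ s ∈ box i, ENNReal.ofReal (Real.exp (-(2 * S)) *
      Real.exp (-(2 * colSum B j * N))) ≤
      ENNReal.ofReal (Real.exp (2 * ∑ l, (colSum B l : ℝ) * s l)) *
        D.indicator 1 (fun i => ∑ l, (matrixA B i l : ℝ) * s l) := by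
    intro i s hs
    have e1 := sum_mul_bounds_of_mem_box (x := fun l => (b' l : ℝ) - colSum B l) hs
    rw [sum_mul_boxCorner hjk (by simp [hσ, hbj, hbk]), hbj] at e1
    have e2 := sum_mul_bounds_of_mem_box (x := fun l => (colSum B l : ℝ)) hs
    rw [sum_mul_boxCorner hjk (by simp [hσ])] at e2
    have hmem : (fun i => ∑ l, (matrixA B i l : ℝ) * s l) ∈ D := by
      rw [hD, Set.mem_ofPred_eq, sum_exponent_mul_sum_matrixA hβ]
      push_cast at e1
      rw [hL, hM]
      linarith
    rw [Set.indicator_of_mem hmem, Pi.one_apply, mul_one, ← Real.exp_add]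
    refine ENNReal.ofReal_le_ofReal (Real.exp_le_exp.2 ?_)
    rw [hS]
    linarith
  rw [mul_assoc C₀, ENNReal.ofReal_mul hC₀pos.le]
  gcongr
  refine le_trans ?_ (lintegral_mono_set hsub)
  rw [lintegral_biUnion_finset hdisj fun i _ => hboxm i]
  calc ENNReal.ofReal (Real.exp (-(2 * S)) * (N * Real.exp (-(2 * colSum B j * N))))
      = ∑ i ∈ Finset.range N,
          ENNReal.ofReal (Real.exp (-(2 * S)) * Real.exp (-(2 * colSum B j * N))) := by
        rw [Finset.sum_const, Finset.card_range, nsmul_eq_mul, mul_left_comm,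
          ENNReal.ofReal_mul (Nat.cast_nonneg N), ENNReal.ofReal_natCast]
    _ ≤ _ := by
        refine Finset.sum_le_sum fun i _ => ?_
        calc _ = ∫⁻ _ in box i, ENNReal.ofReal (Real.exp (-(2 * S)) *
              Real.exp (-(2 * colSum B j * N))) := by
              rw [setLIntegral_const, hvol, mul_one]
          _ ≤ _ := setLIntegral_mono' (hboxm i) (hpt i)

end CriticalMonomial

/-! ### The torus action -/

instance : IsProbabilityMeasure (volume : Measure UnitAddCircle) :=
  ⟨by rw [AddCircle.measure_univ, ENNReal.ofReal_one]⟩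

/-- The rotation of the coordinates by the element `θ` of the torus. -/
noncomputable def torusRotation {n : ℕ} (θ : Fin n → UnitAddCircle) (z : Fin n → ℂ) : Fin n → ℂ :=
  fun k => (AddCircle.toCircle (θ k) : ℂ) * z k

/-- The class of `x` modulo `2π` as an element of the torus. -/
noncomputable def torusAngle {n : ℕ} (x : Fin n → ℝ) : Fin n → UnitAddCircle :=
  fun k => ((x k / (2 * Real.pi) : ℝ) : UnitAddCircle)

theorem toCircle_torusAngle {n : ℕ} (x : Fin n → ℝ) (k : Fin n) :
    (AddCircle.toCircle (torusAngle x k) : ℂ) = Complex.exp (x k * Complex.I) := by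
  rw [torusAngle, AddCircle.toCircle_apply_mk, Circle.coe_exp]
  congr 2
  norm_cast
  field_simp

theorem torusRotation_add {n : ℕ} (θ θ' : Fin n → UnitAddCircle) (z : Fin n → ℂ) :
    torusRotation (θ + θ') z = torusRotation θ (torusRotation θ' z) := by
  ext k
  simp only [torusRotation, Pi.add_apply, AddCircle.toCircle_add, Circle.coe_mul]
  ring

theorem norm_torusRotation {n : ℕ} (θ : Fin n → UnitAddCircle) (z : Fin n → ℂ) (k : Fin n) :
    ‖torusRotation θ z k‖ = ‖z k‖ := by
  simp [torusRotation, Circle.norm_coe]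

theorem torusRotation_ne_zero {n : ℕ} (θ : Fin n → UnitAddCircle) (z : Fin n → ℂ) (k : Fin n) :
    torusRotation θ z k ≠ 0 ↔ z k ≠ 0 := by
  rw [← norm_ne_zero_iff, norm_torusRotation, norm_ne_zero_iff]

theorem torusRotation_mem_monomialDomain {n : ℕ} (B : Matrix (Fin n) (Fin n) ℤ)
    (θ : Fin n → UnitAddCircle) (z : Fin n → ℂ) :
    torusRotation θ z ∈ monomialDomain B ↔ z ∈ monomialDomain B := by
  simp only [monomialDomain, Set.mem_ofPred_eq, norm_torusRotation, torusRotation_ne_zero]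

theorem norm_monomial_torusRotation {n : ℕ} (β : Fin n → ℤ) (θ : Fin n → UnitAddCircle)
    (z : Fin n → ℂ) : ‖monomial β (torusRotation θ z)‖ = ‖monomial β z‖ := by
  simp only [norm_monomial, norm_torusRotation]

theorem continuous_torusRotation {n : ℕ} :
    Continuous fun p : (Fin n → UnitAddCircle) × (Fin n → ℂ) => torusRotation p.1 p.2 := by
  unfold torusRotation
  have := AddCircle.continuous_toCircle (T := 1)
  fun_prop

theorem measurePreserving_torusRotation {n : ℕ} (θ : Fin n → UnitAddCircle) :
    MeasurePreserving (torusRotation θ) volume volume := by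
  have h : ∀ k, MeasurePreserving (fun w : ℂ => (AddCircle.toCircle (θ k) : ℂ) * w)
      volume volume := fun k => (rotation (AddCircle.toCircle (θ k))).measurePreserving
  exact measurePreserving_pi (fun _ : Fin n => (volume : Measure ℂ)) (fun _ => volume) h

theorem exists_eq_torusRotation_exp {n : ℕ} {z : Fin n → ℂ} (hz : ∀ k, z k ≠ 0) :
    ∃ θ, z = torusRotation θ fun k => Complex.exp (logNorm z k) := by
  refine ⟨torusAngle fun k => (z k).arg, ?_⟩
  ext k
  rw [torusRotation, toCircle_torusAngle, logNorm, ← Complex.ofReal_exp,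
    Real.exp_log (norm_pos_iff.2 (hz k)), mul_comm, Complex.norm_mul_exp_arg_mul_I]

/-! ### Fubini for the torus and an interval -/

section IntervalFubini

variable {X : Type*} [TopologicalSpace X] [T2Space X] [CompactSpace X] [SecondCountableTopology X]
  [MeasurableSpace X] [BorelSpace X] {μ : Measure X} [IsFiniteMeasure μ] {F : X → ℝ → ℂ}

theorem integrable_prod_Ioc_of_continuousOn
    (hF : ContinuousOn (Function.uncurry F) (Set.univ ×ˢ Set.Icc 0 1)) :
    Integrable (Function.uncurry F) (μ.prod (volume.restrict (Set.Ioc 0 1))) := by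
  have h : IntegrableOn (Function.uncurry F) (Set.univ ×ˢ Set.Icc 0 1) (μ.prod volume) :=
    hF.integrableOn_compact (isCompact_univ.prod isCompact_Icc)
  have h' := h.mono_set (Set.prod_mono_right Set.Ioc_subset_Icc_self)
  rwa [IntegrableOn, ← Measure.prod_restrict, Measure.restrict_univ] at h'

theorem integrable_intervalIntegral_of_continuousOn
    (hF : ContinuousOn (Function.uncurry F) (Set.univ ×ˢ Set.Icc 0 1)) :
    Integrable (fun θ => ∫ x in (0 : ℝ)..1, F θ x) μ := by
  simp only [intervalIntegral.integral_of_le zero_le_one]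
  exact (integrable_prod_Ioc_of_continuousOn hF).integral_prod_left

theorem integral_intervalIntegral_swap_of_continuousOn
    (hF : ContinuousOn (Function.uncurry F) (Set.univ ×ˢ Set.Icc 0 1)) :
    ∫ θ, (∫ x in (0 : ℝ)..1, F θ x) ∂μ = ∫ x in (0 : ℝ)..1, (∫ θ, F θ x ∂μ) := by
  simp only [intervalIntegral.integral_of_le zero_le_one]
  exact integral_integral_swap (integrable_prod_Ioc_of_continuousOn hF)

end IntervalFubini

/-! ### Torus averages of holomorphic functions as Laurent coefficients -/

section TorusAverage

variable {n : ℕ} {B : Matrix (Fin n) (Fin n) ℤ} {q : (Fin n → ℂ) → ℂ}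

/-- The part of the domain off the coordinate hyperplanes. -/
def puncturedDomain (B : Matrix (Fin n) (Fin n) ℤ) : Set (Fin n → ℂ) :=
  {z | z ∈ monomialDomain B ∧ ∀ k, z k ≠ 0}

/-- The logarithms of the moduli are (1 − Re ζ)t₀ + (Re ζ)t₁, and the cone is convex. -/
theorem torusRotation_exp_mem_puncturedDomain {t₀ t₁ : Fin n → ℝ} (h₀ : t₀ ∈ logCone B)
    (h₁ : t₁ ∈ logCone B) (θ : Fin n → UnitAddCircle) {ζ : ℂ} (hζ : ζ.re ∈ Set.Icc (0 : ℝ) 1) :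
    torusRotation θ (fun k => Complex.exp (t₀ k + ζ * (t₁ k - t₀ k))) ∈ puncturedDomain B := by
  have hne : ∀ k, (fun k => Complex.exp ((t₀ k : ℂ) + ζ * (t₁ k - t₀ k))) k ≠ 0 :=
    fun k => Complex.exp_ne_zero _
  refine ⟨(torusRotation_mem_monomialDomain B θ _).2 ?_,
    fun k => (torusRotation_ne_zero θ _ k).2 (hne k)⟩
  rw [mem_monomialDomain_iff B hne]
  intro j
  have h : ∀ k, Real.log ‖Complex.exp ((t₀ k : ℂ) + ζ * (t₁ k - t₀ k))‖
      = (1 - ζ.re) * t₀ k + ζ.re * t₁ k := by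
    intro k
    rw [Complex.norm_exp, Real.log_exp]
    simp
    ring
  have h2 : ∑ k, (B j k : ℝ) * ((1 - ζ.re) * t₀ k + ζ.re * t₁ k)
      = (1 - ζ.re) * ∑ k, (B j k : ℝ) * t₀ k + ζ.re * ∑ k, (B j k : ℝ) * t₁ k := by
    rw [Finset.mul_sum, Finset.mul_sum, ← Finset.sum_add_distrib]
    exact Finset.sum_congr rfl fun k _ => by ring
  simp only [h, h2]
  have e0 := h₀ j
  have e1 := h₁ j
  rcases hζ.1.eq_or_lt with h3 | h3
  · rw [← h3]; simpa using e0
  · have := mul_neg_of_pos_of_neg h3 e1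
    have := mul_nonpos_of_nonneg_of_nonpos (sub_nonneg.2 hζ.2) e0.le
    linarith

/-- Cauchy's theorem on the unit square is applied along the complex line through t₀ and t₁, then
averaged over the torus. Moving ζ in the imaginary direction is a rotation, so averages depend only
on Re ζ: the horizontal sides cancel and the vertical ones equate the two averages. -/
theorem integral_torusRotation_exp_eq (hq : DifferentiableOn ℂ q (puncturedDomain B))
    {t₀ t₁ : Fin n → ℝ} (h₀ : t₀ ∈ logCone B) (h₁ : t₁ ∈ logCone B) :
    ∫ θ : Fin n → UnitAddCircle, q (torusRotation θ fun k => Complex.exp (t₀ k)) =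
      ∫ θ : Fin n → UnitAddCircle, q (torusRotation θ fun k => Complex.exp (t₁ k)) := by
  set Q : (Fin n → UnitAddCircle) → ℂ → ℂ := fun θ ζ =>
    q (torusRotation θ fun k => Complex.exp (t₀ k + ζ * (t₁ k - t₀ k))) with hQ
  set strip : Set ℂ := {ζ | ζ.re ∈ Set.Icc (0 : ℝ) 1} with hstrip
  have hdiff : ∀ θ, DifferentiableOn ℂ (Q θ) strip := by
    intro θ
    refine hq.comp (Differentiable.differentiableOn ?_)
      fun ζ hζ => torusRotation_exp_mem_puncturedDomain h₀ h₁ θ hζ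
    unfold torusRotation
    fun_prop
  have hcont : ContinuousOn (Function.uncurry Q) (Set.univ ×ˢ strip) := by
    refine hq.continuousOn.comp (f := fun p : (Fin n → UnitAddCircle) × ℂ =>
      torusRotation p.1 fun k => Complex.exp (t₀ k + p.2 * (t₁ k - t₀ k)))
      (Continuous.continuousOn ?_)
      fun p hp => torusRotation_exp_mem_puncturedDomain h₀ h₁ p.1 hp.2
    have hc : Continuous fun p : (Fin n → UnitAddCircle) × ℂ =>
        (p.1, fun k => Complex.exp (t₀ k + p.2 * (t₁ k - t₀ k))) := by fun_prop
    exact continuous_torusRotation.comp hc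
  have hpath : ∀ c : ℝ → ℂ, Continuous c → (∀ x ∈ Set.Icc (0 : ℝ) 1, c x ∈ strip) →
      ContinuousOn (Function.uncurry fun θ x => Q θ (c x)) (Set.univ ×ˢ Set.Icc 0 1) := by
    intro c hc hcs
    exact hcont.comp (f := fun p : (Fin n → UnitAddCircle) × ℝ => (p.1, c p.2))
      (Continuous.continuousOn (by fun_prop)) fun p hp => ⟨Set.mem_univ _, hcs _ hp.2⟩
  have hshift : ∀ (x : ℂ) (y : ℝ), ∫ θ, Q θ (x + y * Complex.I) = ∫ θ, Q θ x := by
    intro x y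
    have h : ∀ θ, Q θ (x + y * Complex.I)
        = Q (θ + torusAngle fun k => y * (t₁ k - t₀ k)) x := by
      intro θ
      simp only [hQ, torusRotation_add]
      congr 2
      ext k
      rw [torusRotation, toCircle_torusAngle, ← Complex.exp_add]
      congr 1
      push_cast
      ring
    simp only [h]
    exact integral_add_right_eq_self (fun θ => Q θ x) _
  have hbottom := hpath (fun x => (x : ℂ)) (by fun_prop) fun x hx => by simpa [hstrip] using hx
  have htop := hpath (fun x => (x : ℂ) + (1 : ℝ) * Complex.I) (by fun_prop)
    fun x hx => by simpa [hstrip] using hx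
  have hright := hpath (fun y => (1 : ℂ) + y * Complex.I) (by fun_prop)
    fun x hx => by simp [hstrip]
  have hleft := hpath (fun y => (0 : ℂ) + y * Complex.I) (by fun_prop)
    fun x hx => by simp [hstrip]
  have hrect : ∀ θ, (∫ x in (0 : ℝ)..1, Q θ x) - (∫ x in (0 : ℝ)..1, Q θ (x + (1 : ℝ) * Complex.I))
      + Complex.I * (∫ y in (0 : ℝ)..1, Q θ (1 + y * Complex.I))
      - Complex.I * (∫ y in (0 : ℝ)..1, Q θ (0 + y * Complex.I)) = 0 := by
    intro θ
    have h := Complex.integral_boundary_rect_eq_zero_of_differentiableOn (Q θ) 0 (1 + Complex.I)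
      ((hdiff θ).mono fun ζ hζ => by
        have := hζ.1
        simpa [hstrip] using this)
    simpa using h
  have hint := integral_congr_ae (μ := volume) (ae_of_all _ hrect)
  rw [integral_sub, integral_add, integral_sub, integral_const_mul, integral_const_mul,
    integral_intervalIntegral_swap_of_continuousOn hbottom,
    integral_intervalIntegral_swap_of_continuousOn htop,
    integral_intervalIntegral_swap_of_continuousOn hright,
    integral_intervalIntegral_swap_of_continuousOn hleft] at hint
  · simp only [hshift, sub_self] at hint
    simp only [zero_add, intervalIntegral.integral_const, sub_zero, one_smul,
      integral_zero] at hint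
    have h := mul_left_cancel₀ Complex.I_ne_zero (sub_eq_zero.1 hint)
    simp only [hQ] at h
    simpa using h.symm
  · exact integrable_intervalIntegral_of_continuousOn hbottom
  · exact integrable_intervalIntegral_of_continuousOn htop
  · exact (integrable_intervalIntegral_of_continuousOn hbottom).sub
      (integrable_intervalIntegral_of_continuousOn htop)
  · exact (integrable_intervalIntegral_of_continuousOn hright).const_mul _
  · exact ((integrable_intervalIntegral_of_continuousOn hbottom).sub
      (integrable_intervalIntegral_of_continuousOn htop)).add
      ((integrable_intervalIntegral_of_continuousOn hright).const_mul _)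
  · exact (integrable_intervalIntegral_of_continuousOn hleft).const_mul _

/-- The average of a holomorphic function over the torus orbits is constant: it is the constant
coefficient of its Laurent series. -/
theorem integral_torusRotation_eq (hq : DifferentiableOn ℂ q (puncturedDomain B))
    {z z' : Fin n → ℂ} (hz : z ∈ puncturedDomain B) (hz' : z' ∈ puncturedDomain B) :
    ∫ θ : Fin n → UnitAddCircle, q (torusRotation θ z) =
      ∫ θ : Fin n → UnitAddCircle, q (torusRotation θ z') := by
  have h : ∀ w ∈ puncturedDomain B, ∫ θ : Fin n → UnitAddCircle, q (torusRotation θ w)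
      = ∫ θ : Fin n → UnitAddCircle, q (torusRotation θ fun k => Complex.exp (logNorm w k)) := by
    intro w hw
    obtain ⟨θ₀, hθ₀⟩ := exists_eq_torusRotation_exp hw.2
    conv_lhs => rw [hθ₀]
    simp only [← torusRotation_add]
    exact integral_add_right_eq_self
      (fun θ => q (torusRotation θ fun k => Complex.exp (logNorm w k))) θ₀
  rw [h z hz, h z' hz']
  exact integral_torusRotation_exp_eq hq ((mem_monomialDomain_iff B hz.2).1 hz.1)
    ((mem_monomialDomain_iff B hz'.2).1 hz'.1)

theorem monomial_neg (β : Fin n → ℤ) (z : Fin n → ℂ) : monomial (-β) z = (monomial β z)⁻¹ := by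
  simp [monomial, Finset.prod_inv_distrib]

theorem differentiableOn_monomial {β : Fin n → ℤ} {S : Set (Fin n → ℂ)}
    (h : ∀ k, (∀ z ∈ S, z k ≠ 0) ∨ 0 ≤ β k) : DifferentiableOn ℂ (monomial β) S := by
  have : monomial β = fun z : Fin n → ℂ => ∏ k, z k ^ β k := rfl
  rw [this]
  have hk : ∀ k, DifferentiableOn ℂ (fun z : Fin n → ℂ => z k ^ β k) S :=
    fun k => DifferentiableOn.zpow (by fun_prop) (h k)
  intro z hz
  exact (HasFDerivWithinAt.finsetProd fun k _ =>
    (hk k z hz).hasFDerivWithinAt).differentiableWithinAt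

/-- Integrating a holomorphic function against a monomial with any rotation invariant weight picks
out the same Laurent coefficient. -/
theorem exists_integral_conj_monomial_mul_eq (β : Fin n → ℤ) {g : (Fin n → ℂ) → ℂ}
    (hg : DifferentiableOn ℂ g (monomialDomain B)) :
    ∃ M : ℂ, ∀ w : (Fin n → ℂ) → ℂ, (∀ θ z, w (torusRotation θ z) = w z) →
      Integrable (fun z => w z * ((starRingEnd ℂ) (monomial β z) * g z))
        (volume.restrict (monomialDomain B)) →
      ∫ z in monomialDomain B, w z * ((starRingEnd ℂ) (monomial β z) * g z) =
        M * ∫ z in monomialDomain B, w z * (‖monomial β z‖ : ℂ) ^ 2 := by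
  -- The constant Laurent coefficient of z^{−β}g is the z^β coefficient of g; it is chosen before
  -- the weight w.
  set q : (Fin n → ℂ) → ℂ := fun z => monomial (-β) z * g z with hq
  have hne : ∀ z : Fin n → ℂ, (∀ k, z k ≠ 0) → monomial β z ≠ 0 := fun z hz =>
    Finset.prod_ne_zero_iff.2 fun k _ => zpow_ne_zero _ (hz k)
  have hqd : DifferentiableOn ℂ q (puncturedDomain B) :=
    (differentiableOn_monomial fun k => Or.inl fun z hz => hz.2 k).mul (hg.mono fun z hz => hz.1)
  have hUm := measurableSet_monomialDomain B
  obtain ⟨M, hM⟩ : ∃ M : ℂ, ∀ z ∈ puncturedDomain B,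
      ∫ θ : Fin n → UnitAddCircle, q (torusRotation θ z) = M := by
    by_cases h : (puncturedDomain B).Nonempty
    · obtain ⟨z₀, hz₀⟩ := h
      exact ⟨_, fun z hz => integral_torusRotation_eq hqd hz hz₀⟩
    · exact ⟨0, fun z hz => absurd ⟨z, hz⟩ h⟩
  refine ⟨M, fun w hw hint => ?_⟩
  set f : (Fin n → ℂ) → ℂ := (monomialDomain B).indicator
    fun z => w z * ((starRingEnd ℂ) (monomial β z) * g z) with hf
  have hfint : Integrable f := (integrable_indicator_iff hUm).2 hint
  have hmp : MeasurePreserving (fun p : (Fin n → UnitAddCircle) × (Fin n → ℂ) =>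
      (p.1, torusRotation p.1 p.2)) (volume.prod volume) (volume.prod volume) :=
    (MeasurePreserving.id volume).skew_product continuous_torusRotation.measurable
      (ae_of_all _ fun θ => (measurePreserving_torusRotation θ).map_eq)
  have hprod : Integrable (Function.uncurry fun (θ : Fin n → UnitAddCircle) z =>
      f (torusRotation θ z)) (volume.prod volume) :=
    hmp.integrable_comp_of_integrable (hfint.comp_snd _)
  rw [← integral_indicator hUm, ← integral_indicator hUm]
  have h1 : ∫ z, f z = ∫ θ : Fin n → UnitAddCircle, ∫ z, f (torusRotation θ z) := by
    have h : ∀ θ : Fin n → UnitAddCircle, ∫ z, f (torusRotation θ z) = ∫ z, f z := by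
      intro θ
      have hmpθ := measurePreserving_torusRotation θ
      have := integral_map hmpθ.measurable.aemeasurable (f := f)
        (by rw [hmpθ.map_eq]; exact hfint.aestronglyMeasurable)
      rw [← this, hmpθ.map_eq]
    simp [h]
  rw [h1, integral_integral_swap hprod, ← integral_const_mul]
  refine integral_congr_ae ?_
  filter_upwards [ae_forall_ne_zero n] with z hz
  by_cases hzU : z ∈ monomialDomain B
  · rw [Set.indicator_of_mem hzU, ← hM z ⟨hzU, hz⟩]
    -- On an orbit w and |z^β| are constant, and the conjugate of z^β is |z^β|² z^{−β}.
    have h : ∀ θ, f (torusRotation θ z)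
        = w z * (‖monomial β z‖ : ℂ) ^ 2 * q (torusRotation θ z) := by
      intro θ
      rw [hf, Set.indicator_of_mem ((torusRotation_mem_monomialDomain B θ z).2 hzU), hw,
        ← norm_monomial_torusRotation β θ, ← Complex.conj_mul']
      have := hne _ fun k => (torusRotation_ne_zero θ z k).2 (hz k)
      simp only [hq, monomial_neg]
      field_simp
    simp only [h]
    rw [integral_const_mul, mul_comm]
  · rw [Set.indicator_of_notMem hzU, mul_zero]
    have h : ∀ θ, f (torusRotation θ z) = 0 := fun θ => Set.indicator_of_notMem
      (fun h => hzU ((torusRotation_mem_monomialDomain B θ z).1 h)) _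
    simp [h]

end TorusAverage

/-! ### Weak type bounds and L¹ norms -/

section RealAnalysis

variable {X : Type*} [MeasurableSpace X] {μ : Measure X}

/-- Layer cake split at the height a = m^{1/p}: the total mass bounds the part below, the weak type
inequality the part above, and both are multiples of a. -/
theorem integral_norm_le_of_weakType [IsFiniteMeasure μ] {f : X → ℂ} (hf : Integrable f μ)
    {p C m : ℝ} (hp : 1 < p) (hC : 0 ≤ C) (hm : 0 < m)
    (h : ∀ y, 0 < y → μ {x | y < ‖f x‖} ≤ ENNReal.ofReal (C ^ p / y ^ p) * ENNReal.ofReal m) :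
    ∫ x, ‖f x‖ ∂μ ≤ (μ.real Set.univ + C ^ p / (p - 1)) * m ^ (1 / p) := by
  set a : ℝ := m ^ (1 / p) with ha
  have ha0 : 0 < a := Real.rpow_pos_of_pos hm _
  have hap : a ^ p = m := by
    rw [ha, ← Real.rpow_mul hm.le, one_div_mul_cancel (by linarith), Real.rpow_one]
  have hCp : 0 ≤ C ^ p := Real.rpow_nonneg hC p
  have hsplit : Set.Ioi (0 : ℝ) = Set.Ioc 0 a ∪ Set.Ioi a := (Set.Ioc_union_Ioi_eq_Ioi ha0.le).symm
  have hlow : ∫⁻ t in Set.Ioc 0 a, μ {x | t < ‖f x‖} ≤ ENNReal.ofReal (μ.real Set.univ * a) := by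
    calc _ ≤ ∫⁻ _ in Set.Ioc 0 a, μ Set.univ :=
          lintegral_mono fun t => measure_mono (Set.subset_univ _)
      _ = _ := by
          rw [setLIntegral_const, Real.volume_Ioc, sub_zero, ENNReal.ofReal_mul measureReal_nonneg,
            ofReal_measureReal]
  have hhigh : ∫⁻ t in Set.Ioi a, μ {x | t < ‖f x‖} ≤ ENNReal.ofReal (C ^ p / (p - 1) * a) := by
    have hint : IntegrableOn (fun t : ℝ => C ^ p * m * t ^ (-p)) (Set.Ioi a) :=
      (integrableOn_Ioi_rpow_of_lt (by linarith) ha0).const_mul _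
    calc _ ≤ ∫⁻ t in Set.Ioi a, ENNReal.ofReal (C ^ p * m * t ^ (-p)) := by
          refine setLIntegral_mono' measurableSet_Ioi fun t ht => ?_
          have ht0 : 0 < t := ha0.trans ht
          refine (h t ht0).trans_eq ?_
          rw [← ENNReal.ofReal_mul (by positivity), Real.rpow_neg ht0.le]
          congr 1
          ring
      _ = ENNReal.ofReal (∫ t in Set.Ioi a, C ^ p * m * t ^ (-p)) := by
          refine (ofReal_integral_eq_lintegral_ofReal hint ?_).symm
          filter_upwards [ae_restrict_mem measurableSet_Ioi] with t ht
          have ht0 : 0 < t := ha0.trans ht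
          have := Real.rpow_nonneg ht0.le (-p)
          positivity
      _ = _ := by
          rw [integral_const_mul, integral_Ioi_rpow_of_lt (by linarith) ha0]
          congr 1
          have h1 : a = m * a ^ (-p + 1) := by
            rw [← hap, ← Real.rpow_add ha0]; simp
          have h2 : p - 1 ≠ 0 := by linarith
          have h3 : -p + 1 ≠ 0 := by linarith
          conv_rhs => rw [h1]
          field_simp
          ring
  have htot : ENNReal.ofReal (∫ x, ‖f x‖ ∂μ) ≤
      ENNReal.ofReal ((μ.real Set.univ + C ^ p / (p - 1)) * a) := by
    rw [ofReal_integral_eq_lintegral_ofReal hf.norm (ae_of_all _ fun _ => norm_nonneg _),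
      lintegral_eq_lintegral_meas_lt μ (ae_of_all _ fun _ => norm_nonneg _) hf.1.norm.aemeasurable,
      hsplit, lintegral_union measurableSet_Ioi (Set.Ioc_disjoint_Ioi le_rfl), add_mul,
      ENNReal.ofReal_add (by positivity)
        (mul_nonneg (div_nonneg hCp (by linarith)) ha0.le)]
    exact add_le_add hlow hhigh
  refine (ENNReal.ofReal_le_ofReal_iff ?_).1 htot
  exact mul_nonneg (add_nonneg measureReal_nonneg (div_nonneg hCp (by linarith))) ha0.le

/-- Test with the parts of F where u ≥ 0 and where u ≤ 0. -/
theorem setIntegral_abs_le_of_forall_subset {u : X → ℝ} (hum : Measurable u)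
    (hu : Integrable u μ) {F : Set X} (hF : MeasurableSet F) {K : ℝ}
    (h : ∀ E ⊆ F, MeasurableSet E → |∫ x in E, u x ∂μ| ≤ K) :
    ∫ x in F, |u x| ∂μ ≤ 2 * K := by
  have h1 := integral_norm_eq_pos_sub_neg (hu.integrableOn (s := F))
  have m1 : MeasurableSet {x | 0 ≤ u x} := measurableSet_le measurable_const hum
  have m2 : MeasurableSet {x | u x ≤ 0} := measurableSet_le hum measurable_const
  rw [Measure.restrict_restrict m1, Measure.restrict_restrict m2] at h1
  have e1 := h _ Set.inter_subset_right (m1.inter hF)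
  have e2 := h _ Set.inter_subset_right (m2.inter hF)
  simp only [Real.norm_eq_abs] at h1
  rw [h1]
  linarith [(abs_le.1 e1).2, (abs_le.1 e2).1]

theorem setIntegral_norm_le_of_forall_subset {f : X → ℂ} (hfm : Measurable f)
    (hf : Integrable f μ) {F : Set X} (hF : MeasurableSet F) {K : ℝ}
    (h : ∀ E ⊆ F, MeasurableSet E → ‖∫ x in E, f x ∂μ‖ ≤ K) :
    ∫ x in F, ‖f x‖ ∂μ ≤ 4 * K := by
  have hre := setIntegral_abs_le_of_forall_subset (Complex.measurable_re.comp hfm) hf.re hF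
    fun E hEF hE => by
      have h1 : ∫ x in E, (f x).re ∂μ = (∫ x in E, f x ∂μ).re := integral_re hf.integrableOn
      exact (congrArg abs h1).le.trans ((Complex.abs_re_le_norm _).trans (h E hEF hE))
  have him := setIntegral_abs_le_of_forall_subset (Complex.measurable_im.comp hfm) hf.im hF
    fun E hEF hE => by
      have h1 : ∫ x in E, (f x).im ∂μ = (∫ x in E, f x ∂μ).im := integral_im hf.integrableOn
      exact (congrArg abs h1).le.trans ((Complex.abs_im_le_norm _).trans (h E hEF hE))
  have hr : Integrable (fun x => |(f x).re|) μ := hf.re.abs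
  have hi : Integrable (fun x => |(f x).im|) μ := hf.im.abs
  have hsum : ∫ x in F, ‖f x‖ ∂μ ≤ ∫ x in F, (|(f x).re| + |(f x).im|) ∂μ :=
    integral_mono hf.norm.integrableOn (hr.add hi).integrableOn
      fun x => Complex.norm_le_abs_re_add_abs_im (f x)
  rw [integral_add hr.integrableOn hi.integrableOn] at hsum
  simp only [Function.comp_apply] at hre him
  linarith

end RealAnalysis

/-! ### The Bergman projection and the monomial -/

section BergmanMonomial

variable {n : ℕ} {B : Matrix (Fin n) (Fin n) ℤ} {β : Fin n → ℤ}

theorem ae_monomial_ne_zero (β : Fin n → ℤ) :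
    ∀ᵐ z : Fin n → ℂ, monomial β z ≠ 0 := by
  filter_upwards [ae_forall_ne_zero n] with z hz
  exact Finset.prod_ne_zero_iff.2 fun k _ => zpow_ne_zero _ (hz k)

/-- The Bergman projection maps the unimodular function `z ^ β / |z ^ β|` to a positive multiple of
the monomial `z ^ β`; by self-adjointness the pairing of an indicator function with the monomial is
controlled by the `L¹` norm of its projection. -/
theorem exists_norm_integral_monomial_le [IsFiniteMeasure (volume.restrict (monomialDomain B))]
    (hne : volume.restrict (monomialDomain B) ≠ 0)
    (he : MemLp (monomial β) 2 (volume.restrict (monomialDomain B)))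
    (hd : DifferentiableOn ℂ (monomial β) (monomialDomain B)) :
    ∃ c : ℝ, 0 < c ∧ ∀ (E : Set (Fin n → ℂ)) (hE : MeasurableSet E)
      (hμE : volume.restrict (monomialDomain B) E ≠ ⊤),
      c * ‖∫ z in E, monomial β z ∂(volume.restrict (monomialDomain B))‖ ≤
        ∫ z, ‖bergmanProjection (monomialDomain B) (indicatorConstLp 2 hE hμE (1 : ℂ)) z‖
          ∂(volume.restrict (monomialDomain B)) := by
  set μ := volume.restrict (monomialDomain B) with hμ
  set e := monomial β with he_def
  have hem : Measurable e := measurable_monomial β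
  have he0 : ∀ᵐ z ∂μ, e z ≠ 0 := ae_restrict_of_ae (ae_monomial_ne_zero β)
  have hi1 : Integrable (fun z => ‖e z‖) μ := (he.integrable one_le_two).norm
  have hi2 : Integrable (fun z => ‖e z‖ ^ 2) μ := (memLp_two_iff_integrable_sq_norm he.1).1 he
  have hpos : ∀ r : ℕ, Integrable (fun z => ‖e z‖ ^ r) μ → 0 < ∫ z, ‖e z‖ ^ r ∂μ := by
    intro r hr
    refine lt_of_le_of_ne (integral_nonneg fun z => by positivity) fun h0 => hne ?_
    have h1 := (integral_eq_zero_iff_of_nonneg (fun z => by positivity) hr).1 h0.symm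
    have h2 : ∀ᵐ _ ∂μ, False := by
      filter_upwards [h1, he0] with z hz hz0
      exact (pow_pos (norm_pos_iff.2 hz0) r).ne' hz
    rwa [Filter.eventually_false_iff_eq_bot, ae_eq_bot] at h2
  have h1pos := hpos 1 (by simpa using hi1)
  have h2pos := hpos 2 hi2
  simp only [pow_one] at h1pos
  -- This is the value for which ∫ (|e| − c|e|²) = 0, so that φ − c e is orthogonal to e.
  set c : ℝ := (∫ z, ‖e z‖ ∂μ) / ∫ z, ‖e z‖ ^ 2 ∂μ with hc
  have hcpos : 0 < c := div_pos h1pos h2pos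
  set φ : (Fin n → ℂ) → ℂ := fun z => (‖e z‖⁻¹ : ℝ) * e z with hφ
  have hφle : ∀ z, ‖φ z‖ ≤ 1 := by
    intro z
    rw [hφ, norm_mul, Complex.norm_real, norm_inv, norm_norm]
    exact inv_mul_le_one
  have hφL : MemLp φ 2 μ := MemLp.of_bound (by
    exact (Complex.measurable_ofReal.comp hem.norm.inv).mul hem |>.aestronglyMeasurable) 1
    (ae_of_all _ hφle)
  set K := (bergmanSpace (monomialDomain B)).topologicalClosure with hK
  have heK : he.toLp ∈ K :=
    Submodule.le_topologicalClosure _ ⟨e, hd, he.coeFn_toLp⟩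
  have horth : hφL.toLp - (c : ℂ) • he.toLp ∈ (bergmanSpace (monomialDomain B))ᗮ := by
    rw [Submodule.mem_orthogonal']
    rintro v ⟨g, hg, hvg⟩
    obtain ⟨M, hM⟩ := exists_integral_conj_monomial_mul_eq β hg
    -- φ − c e is w e with w rotation invariant, so its pairing with any holomorphic g is a multiple
    -- of ∫ w|e|², which vanishes by the choice of c.
    set w : (Fin n → ℂ) → ℂ := fun z => ((‖e z‖⁻¹ - c : ℝ) : ℂ) with hw
    have hinner : ∀ᵐ z ∂μ, inner ℂ ((hφL.toLp - (c : ℂ) • he.toLp) z) (v z)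
        = w z * ((starRingEnd ℂ) (e z) * g z) := by
      filter_upwards [hvg, Lp.coeFn_sub hφL.toLp ((c : ℂ) • he.toLp), Lp.coeFn_smul (c : ℂ) he.toLp,
        hφL.coeFn_toLp, he.coeFn_toLp] with z h1 h2 h3 h4 h5
      rw [h1, h2, Pi.sub_apply, h3, Pi.smul_apply, h4, h5, RCLike.inner_apply, hφ, hw]
      simp only [smul_eq_mul, map_sub, map_mul, Complex.conj_ofReal]
      push_cast
      ring
    have hint := (L2.integrable_inner (𝕜 := ℂ) (hφL.toLp - (c : ℂ) • he.toLp) v).congr hinner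
    rw [L2.inner_def, integral_congr_ae hinner, hM w (fun θ z => by
      simp only [hw, he_def, norm_monomial_torusRotation]) hint]
    have hz : ∫ z, w z * (‖e z‖ : ℂ) ^ 2 ∂μ = ((∫ z, (‖e z‖ - c * ‖e z‖ ^ 2) ∂μ : ℝ) : ℂ) := by
      rw [← integral_complex_ofReal]
      refine integral_congr_ae ?_
      filter_upwards [he0] with z hz
      have : (‖e z‖ : ℂ) ≠ 0 := by exact_mod_cast norm_ne_zero_iff.2 hz
      simp only [hw]
      push_cast
      field_simp
    rw [hz, integral_sub hi1 (hi2.const_mul c), integral_const_mul, hc,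
      div_mul_cancel₀ _ h2pos.ne', sub_self, Complex.ofReal_zero, mul_zero]
  have hP : K.starProjection hφL.toLp = (c : ℂ) • he.toLp := by
    refine Submodule.eq_starProjection_of_mem_of_inner_eq_zero (K.smul_mem _ heK) ?_
    rw [← Submodule.mem_orthogonal', hK, Submodule.orthogonal_closure]
    exact horth
  refine ⟨c, hcpos, fun E hE hμE => ?_⟩
  set T := indicatorConstLp 2 hE hμE (1 : ℂ) with hT
  have h1 : inner ℂ T he.toLp = ∫ z in E, e z ∂μ := by
    rw [hT, L2.inner_indicatorConstLp_one]
    exact integral_congr_ae (ae_restrict_of_ae he.coeFn_toLp)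
  have h2 : inner ℂ (K.starProjection T) hφL.toLp = (c : ℂ) * ∫ z in E, e z ∂μ := by
    rw [Submodule.inner_starProjection_left_eq_right, hP, inner_smul_right, h1]
  have h3 : c * ‖∫ z in E, e z ∂μ‖ = ‖inner ℂ (K.starProjection T) hφL.toLp‖ := by
    rw [h2, norm_mul, Complex.norm_real, Real.norm_eq_abs, abs_of_pos hcpos]
  rw [h3, L2.inner_def]
  refine norm_integral_le_of_norm_le ((Lp.memLp _).integrable one_le_two).norm ?_
  filter_upwards [hφL.coeFn_toLp] with z hz
  refine (norm_inner_le_norm _ _).trans ?_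
  rw [hz]
  exact mul_le_of_le_one_right (norm_nonneg _) (hφle z)

end BergmanMonomial

/-- The exponent comparison that turns the logarithmic factor `N` into a contradiction. -/
theorem not_forall_distribution_le {κ c M K : ℝ} (hκ : 1 < κ) (hc : 0 < c) :
    ¬ ∀ N : ℕ, 0 < N → ∃ m : ℝ, c * (N * Real.exp (-(2 * κ * N))) ≤ m ∧
      Real.exp ((κ - 1) * N - M) * m ≤ K * m ^ (1 / (2 * κ / (κ + 1))) := by
  intro h
  -- r = 1 − 1/p = 1/q for p = 2κ/(κ+1). Raising the lower bound for m to this power cancels the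
  -- exponential level exactly and leaves N^r, which is unbounded.
  set r : ℝ := (κ - 1) / (2 * κ) with hr
  have hr0 : 0 < r := div_pos (by linarith) (by linarith)
  have hle : ∀ N : ℕ, 0 < N → (N : ℝ) ^ r ≤ K * Real.exp M / c ^ r := by
    intro N hN
    obtain ⟨m, h1, h2⟩ := h N hN
    have hN' : (0 : ℝ) < N := by exact_mod_cast hN
    have hm : 0 < m := lt_of_lt_of_le (by positivity) h1
    have hsplit : m = m ^ (1 / (2 * κ / (κ + 1))) * m ^ r := by
      rw [← Real.rpow_add hm]
      conv_lhs => rw [← Real.rpow_one m]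
      congr 1
      rw [hr]
      field_simp
      ring
    have hmpos : 0 < m ^ (1 / (2 * κ / (κ + 1))) := Real.rpow_pos_of_pos hm _
    have h3 : Real.exp ((κ - 1) * N - M) * m ^ r ≤ K := by
      refine le_of_mul_le_mul_right ?_ hmpos
      calc _ = Real.exp ((κ - 1) * N - M) * m := by
            conv_rhs => rw [hsplit]
            ring
        _ ≤ _ := h2
    have h4 : (c * (N * Real.exp (-(2 * κ * N)))) ^ r ≤ m ^ r :=
      Real.rpow_le_rpow (by positivity) h1 hr0.le
    have h5 : (c * (N * Real.exp (-(2 * κ * N)))) ^ r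
        = c ^ r * (N : ℝ) ^ r * Real.exp (-((κ - 1) * N)) := by
      rw [Real.mul_rpow hc.le (by positivity), Real.mul_rpow hN'.le (Real.exp_pos _).le,
        ← Real.exp_mul, ← mul_assoc]
      congr 2
      rw [hr]
      field_simp
    have h6 : Real.exp ((κ - 1) * N - M) * Real.exp (-((κ - 1) * N)) = Real.exp (-M) := by
      rw [← Real.exp_add]; congr 1; ring
    have h7 : c ^ r * (N : ℝ) ^ r * Real.exp (-M) ≤ K := by
      calc _ = Real.exp ((κ - 1) * N - M) * (c ^ r * (N : ℝ) ^ r * Real.exp (-((κ - 1) * N))) := by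
            rw [← h6]; ring
        _ ≤ Real.exp ((κ - 1) * N - M) * m ^ r := by
            rw [← h5]; gcongr
        _ ≤ K := h3
    rw [le_div_iff₀ (Real.rpow_pos_of_pos hc r)]
    calc (N : ℝ) ^ r * c ^ r = c ^ r * (N : ℝ) ^ r * Real.exp (-M) * Real.exp M := by
          rw [mul_assoc _ (Real.exp (-M)), ← Real.exp_add]; simp [mul_comm]
      _ ≤ K * Real.exp M := by gcongr
  have hlim := (tendsto_rpow_atTop hr0).comp tendsto_natCast_atTop_atTop
  obtain ⟨N, hN1, hN2⟩ := ((hlim.eventually_gt_atTop (K * Real.exp M / c ^ r)).and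
    (Filter.eventually_gt_atTop 0)).exists
  exact absurd (hle N hN2) (not_le.2 hN1)

end MonomialPolyhedra

/-! ### The contradiction -/

theorem mainTheorem3 {n : ℕ} (hn : 2 ≤ n) (B : Matrix (Fin n) (Fin n) ℤ)
    (hB : IsMonomialPolyhedron B)
    (hnontrivial : monomialDomain B ≠ unitPolydisc n)
    (hm : 1 < numMax B)
    (hα : ∀ i : Fin n, (i : ℕ) < numMax B → ∀ l, alpha B l ≤ alpha B i)
    (b : Fin n → ℤ) (hb : IsDeckInvariant B (monomial b))
    (j k : Fin n) (hjk : j < k) (hk : (k : ℕ) < numMax B)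
    (hbj : b j = 1) (hbk : b k = 1) :
    ¬ IsRestrictedWeakType (bergmanProjection (monomialDomain B)) (pStar B) := by
  obtain ⟨d, hd, hBA, hA⟩ := exists_mul_matrixA_eq_diagonal hB
  have hσ := one_le_colSum hd hBA hA
  have hj : ∀ l, colSum B l ≤ colSum B j := fun l => by
    have := hα j ((Fin.lt_def.1 hjk).trans hk) l
    simpa [alpha] using this
  have hkmax : ∀ l, colSum B l ≤ colSum B k := fun l => by
    have := hα k hk l
    simpa [alpha] using this
  have hjk_eq : colSum B j = colSum B k := le_antisymm (hkmax j) (hj k)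
  have hκ : 1 < colSum B j := by
    by_contra! h
    exact hnontrivial (monomialDomain_eq_unitPolydisc hd hBA hA fun l =>
      le_antisymm ((hj l).trans h) (hσ l))
  have hκR : (1 : ℝ) < colSum B j := by exact_mod_cast hκ
  obtain ⟨β, b', hβ, hb', hb'j, hb'k⟩ := exists_critical_exponent hd hBA hb hbj hbk
  obtain ⟨c, M, hc, hdist⟩ :=
    exists_distribution_lower_bound hd hBA hβ hjk.ne hjk_eq hb'j hb'k
  set μ := volume.restrict (monomialDomain B) with hμ
  have hfin : IsFiniteMeasure μ :=
    ⟨by rw [hμ, Measure.restrict_apply_univ]; exact hB.bounded.measure_lt_top⟩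
  have hne : μ ≠ 0 := by
    intro h0
    -- The distribution bound at N = 1 already shows that the domain has positive measure.
    have h1 := hdist 1
    rw [h0, Measure.coe_zero, Pi.zero_apply, nonpos_iff_eq_zero, ENNReal.ofReal_eq_zero] at h1
    exact absurd h1 (not_le.2 (by positivity))
  have hmem := memLp_monomial hd hBA hβ hb'
  have hhol : DifferentiableOn ℂ (monomial β) (monomialDomain B) := by
    refine differentiableOn_monomial fun i => ?_
    by_cases h : ∀ l, 0 ≤ B l i
    · exact Or.inr (nonneg_of_column_nonneg hd hBA hβ hb' h)
    · push Not at h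
      obtain ⟨l, hl⟩ := h
      exact Or.inl fun z hz => (hz l).1 i hl
  obtain ⟨c', hc', hproj⟩ := exists_norm_integral_monomial_le hne hmem hhol
  rintro ⟨C, hC, hweak⟩
  set p := pStar B with hp
  have hpeq : p = 2 * (colSum B j : ℝ) / ((colSum B j : ℝ) + 1) := pStar_eq hσ hj
  have hp1 : 1 < p := by
    rw [hpeq, lt_div_iff₀ (by linarith)]
    linarith
  set D : ℝ := μ.real Set.univ + C ^ p / (p - 1) with hD
  refine not_forall_distribution_le (κ := colSum B j) (M := M) (K := 4 * (D / c')) hκR hc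
    fun N hN => ?_
  set lam : ℝ := Real.exp (((colSum B j : ℝ) - 1) * N - M) with hlam
  set F : Set (Fin n → ℂ) := {z | lam < ‖monomial β z‖} with hF
  have hFm : MeasurableSet F := measurableSet_lt measurable_const (measurable_monomial β).norm
  have hlow : c * (N * Real.exp (-(2 * colSum B j * N))) ≤ μ.real F :=
    (ENNReal.ofReal_le_iff_le_toReal (measure_ne_top μ F)).1 (hdist N)
  have hN' : (0 : ℝ) < N := by exact_mod_cast hN
  have hFpos : 0 < μ.real F := lt_of_lt_of_le (by positivity) hlow
  refine ⟨μ.real F, hlow, ?_⟩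
  have he1 : Integrable (monomial β) μ := hmem.integrable one_le_two
  -- The measure of F majorizes that of E, which gives one bound for all subsets; that uniformity
  -- lets the modulus be moved inside the integral over F.
  have hsub : ∀ E ⊆ F, MeasurableSet E →
      ‖∫ z in E, monomial β z ∂μ‖ ≤ D / c' * μ.real F ^ (1 / p) := by
    intro E hEF hE
    have h1 := hproj E hE (measure_ne_top μ E)
    have h2 := integral_norm_le_of_weakType (μ := μ)
      ((Lp.memLp (bergmanProjection (monomialDomain B)
        (indicatorConstLp 2 hE (measure_ne_top μ E) (1 : ℂ)))).integrable one_le_two)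
      hp1 hC.le hFpos fun y hy => by
        refine (hweak E hE (measure_ne_top μ E) y hy).trans ?_
        rw [ofReal_measureReal]
        gcongr
    have h3 := h1.trans h2
    rw [div_mul_eq_mul_div, le_div_iff₀ hc', mul_comm]
    exact h3
  have hF1 := setIntegral_norm_le_of_forall_subset (measurable_monomial β) he1 hFm hsub
  have hF2 : lam * μ.real F ≤ ∫ z in F, ‖monomial β z‖ ∂μ := by
    have h1 : ∫ _ in F, lam ∂μ = lam * μ.real F := by
      rw [setIntegral_const, smul_eq_mul, mul_comm]
    rw [← h1]
    exact setIntegral_mono_on (integrable_const _).integrableOn he1.norm.integrableOn hFm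
      fun z hz => le_of_lt hz
  rw [← hpeq, mul_assoc]
  exact hF2.trans hF1
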